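/- **Conventions.** An operator space (o.s.) is a closed linear subspace of $B(H)$ for a complex Hilbert space $H$; $M_n(X)$ carries the norm inherited from $M_n(B(H)) = B(H^n)$, $\|\cdot\|_{cb}$ is the completely bounded norm, and f.d. means finite-dimensional. For an injective linear map $u$ from $S$ onto $u(S)$ put $D(u)=\|u\|_{cb}\,\|u^{-1}|_{u(S)}\|_{cb}$ (with $D(u)=1$ if $S=\{0\}$). For $\varepsilon>0$, $u$ is an $\varepsilon$-embedding if it is injective and $\|u\|_{cb}\le 1+\varepsilon$, $\|u^{-1}|_{u(S)}\|_{cb}\le 1+\varepsilon$. Put $d_{cb}(E,F)=\inf D(u)$ over all linear isomorphisms $u:E\to F$ ($=\infty$ if there are none). Let $\mathcal E$ be a class of f.d. operator spaces containing a nonzero space; completely isometrically isomorphic spaces are identified. Put $d_{cb}(E,\mathcal E)=\inf_{F\in\mathcal E}d_{cb}(E,F)$. - $\mathcal E$ is *separable* if there is a countable $\mathcal E'\subset\mathcal E$ such that for all $E\in\mathcal E$ and $\varepsilon>0$ there is $E'\in\mathcal E'$ with $d_{cb}(E,E')<1+\varepsilon$. - $\mathcal E$ is *Gurarii* if for all $L,E\in\mathcal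 E$, every subspace $S\subset L$, every injective linear $u:S\to E$ and every $\delta>0$ there are $E_1\in\mathcal E$, a completely isometric linear map $\varphi:E\to E_1$ and an injective linear $\tilde u:L\to E_1$ with $\tilde u|_S=\varphi u$ and $D(\tilde u)\le(1+\delta)D(u)$. It is *loosely Gurarii* if, for every $\varepsilon>0$, this holds with $\varphi$ required only to be an $\varepsilon$-embedding. - An o.s. $Y$ *locally embeds in* $\mathcal E$ if for every f.d. subspace $F\subset Y$ and $\varepsilon>0$ there are $F_1\in\mathcal E$ and a subspace $\hat F\subset F_1$ with $d_{cb}(F,\hat F)\le 1+\varepsilon$. - An o.s. $X$ is an *$\mathcal E$-Gurarii space* if it is separable, locally embeds in $\mathcal E$, and for every $\varepsilon>0$, $L\in\mathcal E$, subspace $S\subset L$ and injective linear $u:S\to X$ there is an injective linear $\tilde u:L\to X$ extending $u$ with $D(\tilde u)\le(1+\varepsilon)D(u)$. **Theorem 4.22.** Let $\mathcal E$ be a separable class as above. (1) If $\mathcal E$ is loosely Gurarii, then for every separable o.s. $Y$ that locally embeds in $\mathcal E$ there are an $\mathcal E$-Gurarii space $X$, a completely isometric linear map $Y\to X$, and an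 increasing sequence $(E_n)$ of f.d. subspaces of $X$ such that $X=\overline{\bigcup_n E_n}$ and $d_{cb}(E_n,\mathcal E)\to 1$. (2) If $\mathcal E$ is Gurarii, there is an $\mathcal E$-Gurarii space $X$ of the form $X=\overline{\bigcup_n E_n}$ for an increasing sequence of f.d. subspaces $E_n$ with $E_n\in\mathcal E$ for all $n$, such that for every separable o.s. $Y$ that locally embeds in $\mathcal E$ and every $\varepsilon>0$ there is an $\varepsilon$-embedding of $Y$ in $X$. -/

import Mathlib

open Filter Topology TopologicalSpace
open scoped ENNReal

universe u

noncomputable section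

/-- The operator on the Hilbert sum `H ⊕ ⋯ ⊕ H` (`n` copies, with the `ℓ²` norm) that is given by an
`n × n` matrix of bounded operators on `H`: `(a ξ)_i = ∑_j a_ij ξ_j`. This is the identification
of `M_n(B(H))` with `B(Hⁿ)`. -/
def matrixOperator {H : Type*} [NormedAddCommGroup H] [InnerProductSpace ℂ H] {n : ℕ}
    (a : Matrix (Fin n) (Fin n) (H →L[ℂ] H)) :
    PiLp 2 (fun _ : Fin n => H) →L[ℂ] PiLp 2 (fun _ : Fin n => H) :=
  ((PiLp.continuousLinearEquiv 2 ℂ (fun _ : Fin n => H)).symm :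
      (Fin n → H) →L[ℂ] PiLp 2 (fun _ : Fin n => H)) ∘L
    ContinuousLinearMap.pi
      (fun i => ∑ j, (a i j) ∘L (PiLp.proj 2 (fun _ : Fin n => H) j : _ →L[ℂ] H))

/-- Notation class for the sequence of norms on the spaces `M_n(V)`. The only instances are
`V = B(H)` and, by restriction, its subspaces and their subspaces. -/
class MatrixNorms (V : Type*) where
  /-- the norm on `M_n(V)` -/
  mnorm : {n : ℕ} → Matrix (Fin n) (Fin n) V → ℝ

/-- `M_n(B(H))` is normed as `B(Hⁿ)`. -/
instance instMatrixNormsOperators (H : Type*) [NormedAddCommGroup H] [InnerProductSpace ℂ H] :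
    MatrixNorms (H →L[ℂ] H) :=
  ⟨fun a => ‖matrixOperator a‖⟩

/-- A subspace `S ⊆ V` carries the norms that `M_n(S)` inherits from `M_n(V)`. -/
instance instMatrixNormsSubmodule {V : Type*} [AddCommGroup V] [Module ℂ V] [MatrixNorms V]
    (S : Submodule ℂ V) : MatrixNorms S :=
  ⟨fun a => MatrixNorms.mnorm (a.map (fun s : S => (s : V)))⟩

/-- An operator space: a closed linear subspace of `B(H)`, for a complex Hilbert space `H`. -/
structure OpSpace : Type (u + 1) where
  /-- the underlying Hilbert space -/
  H : Type u
  [normedAddCommGroup : NormedAddCommGroup H]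
  [innerProductSpace : InnerProductSpace ℂ H]
  [completeSpace : CompleteSpace H]
  /-- the subspace of `B(H)` -/
  space : Submodule ℂ (H →L[ℂ] H)
  isClosed_space : IsClosed (space : Set (H →L[ℂ] H))

attribute [instance] OpSpace.normedAddCommGroup OpSpace.innerProductSpace OpSpace.completeSpace

/-- The elements of an operator space, with the structure inherited from `B(H)`. -/
def OpSpace.Elem (X : OpSpace.{u}) : Type u := X.space

instance : CoeSort OpSpace.{u} (Type u) := ⟨OpSpace.Elem⟩

instance (X : OpSpace.{u}) : NormedAddCommGroup X :=
  inferInstanceAs (NormedAddCommGroup X.space)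

instance (X : OpSpace.{u}) : NormedSpace ℂ X := inferInstanceAs (NormedSpace ℂ X.space)

instance (X : OpSpace.{u}) : MatrixNorms X := inferInstanceAs (MatrixNorms X.space)

section Maps

variable {V W : Type*} [AddCommGroup V] [Module ℂ V] [MatrixNorms V]
  [AddCommGroup W] [Module ℂ W] [MatrixNorms W]

/-- The completely bounded norm `‖u‖_cb = sup_n ‖id ⊗ u : M_n(V) → M_n(W)‖`, with value `∞` if `u`
is not completely bounded. -/
def cbNorm (u : V →ₗ[ℂ] W) : ℝ≥0∞ :=
  ⨆ (n : ℕ) (x : Matrix (Fin n) (Fin n) V) (_ : MatrixNorms.mnorm x ≤ 1),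
    ENNReal.ofReal (MatrixNorms.mnorm (x.map u))

/-- For an injective map `u`, the completely bounded norm of `u⁻¹ : u(V) → V`. -/
def cbNormInv (u : V →ₗ[ℂ] W) (hu : Function.Injective u) : ℝ≥0∞ :=
  cbNorm ((LinearEquiv.ofInjective u hu).symm : LinearMap.range u →ₗ[ℂ] V)

/-- The distortion `D(u) = ‖u‖_cb ‖u⁻¹|_{u(V)}‖_cb` of an injective map. If `V ≠ 0` the product is at
least `1` and the maximum changes nothing; it fixes the convention `D(u) = 1` for `V = 0`. -/
def distortion (u : V →ₗ[ℂ] W) (hu : Function.Injective u) : ℝ≥0∞ :=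
  max 1 (cbNorm u * cbNormInv u hu)

/-- An `ε`-embedding: an injective map with `‖u‖_cb ≤ 1 + ε` and `‖u⁻¹|_{u(V)}‖_cb ≤ 1 + ε`. -/
def IsEpsEmbedding (ε : ℝ) (u : V →ₗ[ℂ] W) : Prop :=
  ∃ hu : Function.Injective u,
    cbNorm u ≤ ENNReal.ofReal (1 + ε) ∧ cbNormInv u hu ≤ ENNReal.ofReal (1 + ε)

/-- A complete isometry (not necessarily surjective). -/
def IsCompleteIsometry (u : V →ₗ[ℂ] W) : Prop :=
  ∀ (n : ℕ) (x : Matrix (Fin n) (Fin n) V),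
    MatrixNorms.mnorm (x.map u) = MatrixNorms.mnorm x

end Maps

section Spaces

variable (V W : Type*) [AddCommGroup V] [Module ℂ V] [MatrixNorms V]
  [AddCommGroup W] [Module ℂ W] [MatrixNorms W]

/-- The Banach-Mazur type distance `d_cb(V, W)`: the infimum of the distortions of the isomorphisms
from `V` onto `W`, and `∞` if there are none. -/
def dcb : ℝ≥0∞ :=
  ⨅ u : V ≃ₗ[ℂ] W, distortion (u : V →ₗ[ℂ] W) u.injective

/-- `d_cb(V, 𝓔) = inf {d_cb(V, F) | F ∈ 𝓔}`. -/
def dcbClass (𝓔 : Set OpSpace.{u}) : ℝ≥0∞ :=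
  ⨅ F ∈ 𝓔, dcb V F

/-- `V` belongs to the class `𝓔`, where completely isometric spaces are identified. -/
def BelongsTo (𝓔 : Set OpSpace.{u}) : Prop :=
  ∃ F ∈ 𝓔, ∃ u : V ≃ₗ[ℂ] F, IsCompleteIsometry (u : V →ₗ[ℂ] F)

/-- `V` locally embeds in `𝓔`: every finite-dimensional subspace of `V` is, up to `1 + ε`, a
subspace of a member of `𝓔`. -/
def LocallyEmbeds (𝓔 : Set OpSpace.{u}) : Prop :=
  ∀ F : Submodule ℂ V, FiniteDimensional ℂ F → ∀ ε : ℝ, 0 < ε →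
    ∃ F₁ ∈ 𝓔, ∃ G : Submodule ℂ F₁, dcb F G ≤ ENNReal.ofReal (1 + ε)

/-- The `𝓔`-Gurarii property: any injective `u : S → V`, where `S ⊆ L ∈ 𝓔`, extends to `L` with
almost the same distortion. -/
def HasGurariiProperty (𝓔 : Set OpSpace.{u}) : Prop :=
  ∀ ε : ℝ, 0 < ε → ∀ L ∈ 𝓔, ∀ (S : Submodule ℂ L) (u : S →ₗ[ℂ] V) (hu : Function.Injective u),
    ∃ (v : L →ₗ[ℂ] V) (hv : Function.Injective v),
      (∀ s : S, v s = u s) ∧ distortion v hv ≤ ENNReal.ofReal (1 + ε) * distortion u hu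

end Spaces

/-- `𝓔` is separable for `d_cb`. -/
def IsSeparableClass (𝓔 : Set OpSpace.{u}) : Prop :=
  ∃ 𝓓 ⊆ 𝓔, 𝓓.Countable ∧
    ∀ E ∈ 𝓔, ∀ ε : ℝ, 0 < ε → ∃ F ∈ 𝓓, dcb E F < ENNReal.ofReal (1 + ε)

/-- A Gurarii class. -/
def IsGurariiClass (𝓔 : Set OpSpace.{u}) : Prop :=
  ∀ L ∈ 𝓔, ∀ E ∈ 𝓔, ∀ (S : Submodule ℂ L) (u : S →ₗ[ℂ] E) (hu : Function.Injective u),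
    ∀ δ : ℝ, 0 < δ → ∃ E₁ ∈ 𝓔, ∃ φ : E →ₗ[ℂ] E₁, IsCompleteIsometry φ ∧
      ∃ (v : L →ₗ[ℂ] E₁) (hv : Function.Injective v),
        (∀ s : S, v s = φ (u s)) ∧ distortion v hv ≤ ENNReal.ofReal (1 + δ) * distortion u hu

/-- A loosely Gurarii class: the embedding `φ` of `E` is only an `ε`-embedding, for any given
`ε > 0`. -/
def IsLooselyGurariiClass (𝓔 : Set OpSpace.{u}) : Prop :=
  ∀ ε : ℝ, 0 < ε →
    ∀ L ∈ 𝓔, ∀ E ∈ 𝓔, ∀ (S : Submodule ℂ L) (u : S →ₗ[ℂ] E) (hu : Function.Injective u),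
    ∀ δ : ℝ, 0 < δ → ∃ E₁ ∈ 𝓔, ∃ φ : E →ₗ[ℂ] E₁, IsEpsEmbedding ε φ ∧
      ∃ (v : L →ₗ[ℂ] E₁) (hv : Function.Injective v),
        (∀ s : S, v s = φ (u s)) ∧ distortion v hv ≤ ENNReal.ofReal (1 + δ) * distortion u hu

/-- An `𝓔`-Gurarii space: separable, with the `𝓔`-Gurarii property, and locally embedding
in `𝓔`. -/
def IsGurariiSpace (𝓔 : Set OpSpace.{u}) (X : OpSpace.{u}) : Prop :=
  SeparableSpace X ∧ HasGurariiProperty X 𝓔 ∧ LocallyEmbeds X 𝓔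

/-- `X` is the closure of the union of the increasing sequence `E` of finite-dimensional
subspaces. -/
def IsFDExhaustion (X : OpSpace.{u}) (E : ℕ → Submodule ℂ X) : Prop :=
  Monotone E ∧ (∀ n, FiniteDimensional ℂ (E n)) ∧ closure (⋃ n, (E n : Set X)) = Set.univ

end

/-! The space `X` is the limit of a chain `L 0 → L 1 → ⋯` of members of `𝓔` whose maps are
completely isometric up to constants with convergent product, arranged so that every extension
problem is eventually solved. Separability leaves countably many problems: every pair `S ⊆ L ∈ 𝓔` is
carried, with distortion close to 1, exactly onto one of a sequence of patterns (`exists_patterns`).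
The injective maps of norm at most `n` from the first `n + 1` patterns into a stage of the chain
have a finite net, and finitely many amalgamations solve the problems posed by the net
(`exists_extendsPatterns`). The limit is realised concretely, by operators on the ultraproduct of
the Hilbert spaces on which the `L n` act (`exists_chain_limit`).

Approximate solutions suffice because on a finite-dimensional space a small norm perturbation is
small in cb norm (`exists_cbLe_of_norm_le`) and barely changes the bounds of an embedding
(`bounds_of_close`). A map `u : S → X` is moved to a pattern, then into some `L n`, then to the net,
and extended there. The remaining error lives on `S`; composed with a projection onto `S` it becomes
a small map on all of `L`, and adding it makes the extension exact (`hasGurariiProperty_limit`).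

For a Gurarii class the chain is completely isometric, so its members sit inside `X`. A separable
`Y` is then embedded along a finite-dimensional exhaustion: the next subspace of `Y` is nearly a
subspace of some `G ∈ 𝓔`, and the Gurarii property of `X` extends the map across `G`. Only
distortions are controlled, so the scale is fixed at one vector of `Y`.

For a loosely Gurarii class, embeddings of an exhaustion of `Y` are built into the chain. The
decisive step is `IsLooselyGurariiClass.exists_improve`: the current stage is amalgamated with a
very good copy `G` of the next subspace of `Y`, with `G` in the role of the space that is embedded
almost isometrically. The new embedding is then as good as desired, whatever the old one was, while
the old stage is moved only by an amount governed by the old quality. With qualities prescribed in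
advance and tending fast to 1, the chain converges and the embedding of `Y` is completely isometric
in the limit. -/

noncomputable section

open MatrixNorms

set_option linter.unusedSectionVars false

/-! ### Norms of matrices of operators -/

section MatrixOperator

variable {H : Type*} [NormedAddCommGroup H] [InnerProductSpace ℂ H] {n : ℕ}

theorem matrixOperator_apply (a : Matrix (Fin n) (Fin n) (H →L[ℂ] H))
    (ξ : PiLp 2 (fun _ : Fin n => H)) (i : Fin n) :
    matrixOperator a ξ i = ∑ j, a i j (ξ j) := by
  simp [matrixOperator]

theorem norm_sq_matrixOperator_apply (a : Matrix (Fin n) (Fin n) (H →L[ℂ] H))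
    (ξ : PiLp 2 (fun _ : Fin n => H)) :
    ‖matrixOperator a ξ‖ ^ 2 = ∑ i, ‖∑ j, a i j (ξ j)‖ ^ 2 := by
  simp [PiLp.norm_sq_eq_of_L2, matrixOperator_apply]

theorem norm_matrixOperator_nonneg (a : Matrix (Fin n) (Fin n) (H →L[ℂ] H)) :
    0 ≤ ‖matrixOperator a‖ :=
  ContinuousLinearMap.opNorm_nonneg _

theorem sum_norm_sq_le_norm_matrixOperator (a : Matrix (Fin n) (Fin n) (H →L[ℂ] H))
    (ξ : Fin n → H) :
    ∑ i, ‖∑ j, a i j (ξ j)‖ ^ 2 ≤ ‖matrixOperator a‖ ^ 2 * ∑ j, ‖ξ j‖ ^ 2 := by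
  have h := (matrixOperator a).le_opNorm (WithLp.toLp 2 ξ)
  have h2 := pow_le_pow_left₀ (norm_nonneg _) h 2
  rw [mul_pow, norm_sq_matrixOperator_apply, PiLp.norm_sq_eq_of_L2] at h2
  simpa using h2

theorem norm_matrixOperator_le {a : Matrix (Fin n) (Fin n) (H →L[ℂ] H)} {M : ℝ} (hM : 0 ≤ M)
    (h : ∀ ξ : Fin n → H, ∑ i, ‖∑ j, a i j (ξ j)‖ ^ 2 ≤ M ^ 2 * ∑ j, ‖ξ j‖ ^ 2) :
    ‖matrixOperator a‖ ≤ M := by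
  refine ContinuousLinearMap.opNorm_le_bound _ hM fun ξ => ?_
  refine le_of_sq_le_sq ?_ (by positivity)
  rw [mul_pow, norm_sq_matrixOperator_apply, PiLp.norm_sq_eq_of_L2]
  exact h _

theorem matrixOperator_add (a b : Matrix (Fin n) (Fin n) (H →L[ℂ] H)) :
    matrixOperator (a + b) = matrixOperator a + matrixOperator b := by
  ext ξ i
  simp [matrixOperator_apply, Finset.sum_add_distrib]

theorem matrixOperator_smul (c : ℂ) (a : Matrix (Fin n) (Fin n) (H →L[ℂ] H)) :
    matrixOperator (c • a) = c • matrixOperator a := by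
  ext ξ i
  simp [matrixOperator_apply, Finset.smul_sum]

theorem norm_matrixOperator_add_le (a b : Matrix (Fin n) (Fin n) (H →L[ℂ] H)) :
    ‖matrixOperator (a + b)‖ ≤ ‖matrixOperator a‖ + ‖matrixOperator b‖ := by
  rw [matrixOperator_add]
  exact ContinuousLinearMap.opNorm_add_le _ _

theorem norm_matrixOperator_smul_le (c : ℂ) (a : Matrix (Fin n) (Fin n) (H →L[ℂ] H)) :
    ‖matrixOperator (c • a)‖ ≤ ‖c‖ * ‖matrixOperator a‖ := by
  rw [matrixOperator_smul]
  exact ContinuousLinearMap.opNorm_smul_le _ _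

theorem norm_entry_le_norm_matrixOperator (a : Matrix (Fin n) (Fin n) (H →L[ℂ] H))
    (i j : Fin n) : ‖a i j‖ ≤ ‖matrixOperator a‖ := by
  refine ContinuousLinearMap.opNorm_le_bound _ (norm_matrixOperator_nonneg a) fun h => ?_
  refine le_of_sq_le_sq ?_ (mul_nonneg (norm_matrixOperator_nonneg a) (norm_nonneg h))
  have := sum_norm_sq_le_norm_matrixOperator a (Pi.single j h)
  have h1 : ∑ k, ‖(Pi.single j h : Fin n → H) k‖ ^ 2 = ‖h‖ ^ 2 := by
    rw [Finset.sum_eq_single j] <;> simp +contextual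
  have h2 : ∀ i, ∑ k, a i k ((Pi.single j h : Fin n → H) k) = a i j h := by
    intro i
    rw [Finset.sum_eq_single j] <;> simp +contextual
  rw [h1] at this
  simp only [h2] at this
  rw [mul_pow]
  exact (Finset.single_le_sum (f := fun i => ‖a i j h‖ ^ 2) (fun _ _ => by positivity)
    (Finset.mem_univ i)).trans this

theorem norm_matrixOperator_one (a : Matrix (Fin 1) (Fin 1) (H →L[ℂ] H)) :
    ‖matrixOperator a‖ = ‖a 0 0‖ := by
  refine le_antisymm (norm_matrixOperator_le (norm_nonneg (a 0 0)) fun ξ => ?_)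
    (norm_entry_le_norm_matrixOperator a 0 0)
  simp only [Finset.univ_unique, Fin.default_eq_zero, Finset.sum_singleton, ← mul_pow]
  exact pow_le_pow_left₀ (norm_nonneg _) ((a 0 0).le_opNorm _) 2

/-- A scalar matrix acts on `Kⁿ` with at most the norm it has on `ℂⁿ`. -/
theorem sum_norm_sq_smul_le {K : Type*} [NormedAddCommGroup K] [InnerProductSpace ℂ K]
    (A : Fin n → Fin n → ℂ) (M : ℝ)
    (h : ∀ z : Fin n → ℂ, ∑ i, ‖∑ j, A i j * z j‖ ^ 2 ≤ M * ∑ j, ‖z j‖ ^ 2) (ζ : Fin n → K) :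
    ∑ i, ‖∑ j, A i j • ζ j‖ ^ 2 ≤ M * ∑ j, ‖ζ j‖ ^ 2 := by
  -- In coordinates for an orthonormal basis of the span of the `ζ j`, both sides split into sums of
  -- scalar inequalities.
  let F : Submodule ℂ K := Submodule.span ℂ (Set.range ζ)
  have : FiniteDimensional ℂ F := FiniteDimensional.span_of_finite ℂ (Set.finite_range ζ)
  let e := stdOrthonormalBasis ℂ F
  let z : Fin n → F := fun j => ⟨ζ j, Submodule.subset_span ⟨j, rfl⟩⟩
  have key : ∀ v : F, ‖v‖ ^ 2 = ∑ k, ‖e.repr v k‖ ^ 2 := by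
    intro v
    rw [← e.repr.norm_map v, PiLp.norm_sq_eq_of_L2]
  have h1 : ∀ i, ‖∑ j, A i j • ζ j‖ ^ 2 = ∑ k, ‖∑ j, A i j * e.repr (z j) k‖ ^ 2 := by
    intro i
    have : ‖∑ j, A i j • ζ j‖ = ‖∑ j, A i j • z j‖ := by
      rw [Submodule.coe_norm]; simp [z]
    rw [this, key]
    simp [map_sum]
  have h2 : ∀ j, ‖ζ j‖ ^ 2 = ∑ k, ‖e.repr (z j) k‖ ^ 2 := fun j => key (z j)
  simp only [h1, h2]
  rw [Finset.sum_comm, Finset.sum_comm (s := Finset.univ (α := Fin n)), Finset.mul_sum]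
  exact Finset.sum_le_sum fun k _ => h fun j => e.repr (z j) k

end MatrixOperator

/-! ### Concretely represented matrix norms -/

/-- The matrix norms of `V` come from an isometric representation of `V` on a Hilbert space. -/
class ConcreteNorms (V : Type u) [NormedAddCommGroup V] [NormedSpace ℂ V] [MatrixNorms V] :
    Prop where
  exists_rep : ∃ (H : Type u) (_ : NormedAddCommGroup H) (_ : InnerProductSpace ℂ H)
    (ι : V →ₗᵢ[ℂ] (H →L[ℂ] H)), ∀ (n : ℕ) (x : Matrix (Fin n) (Fin n) V),
      mnorm x = ‖matrixOperator (x.map ι)‖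

section Rank

variable {V W : Type u} [NormedAddCommGroup V] [NormedSpace ℂ V] [MatrixNorms V]
  [hV : ConcreteNorms V] [NormedAddCommGroup W] [NormedSpace ℂ W] [MatrixNorms W]
  [hW : ConcreteNorms W]

instance (X : OpSpace.{u}) : ConcreteNorms X where
  exists_rep := ⟨X.H, _, _, X.space.subtypeₗᵢ, fun _ _ => rfl⟩

instance (S : Submodule ℂ V) : ConcreteNorms S where
  exists_rep := by
    obtain ⟨H, _, _, ι, hι⟩ := hV.exists_rep
    exact ⟨H, _, _, ι.comp S.subtypeₗᵢ, fun n x => hι n (x.map (fun s : S => (s : V)))⟩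

variable {n : ℕ}

theorem mnorm_nonneg (x : Matrix (Fin n) (Fin n) V) : 0 ≤ mnorm x := by
  obtain ⟨H, _, _, ι, hι⟩ := hV.exists_rep
  rw [hι]; exact norm_matrixOperator_nonneg _

theorem mnorm_add_le (x y : Matrix (Fin n) (Fin n) V) : mnorm (x + y) ≤ mnorm x + mnorm y := by
  obtain ⟨H, _, _, ι, hι⟩ := hV.exists_rep
  rw [hι, hι, hι, Matrix.map_add _ (fun a b => map_add ι a b)]
  exact norm_matrixOperator_add_le _ _

theorem mnorm_smul_le (c : ℂ) (x : Matrix (Fin n) (Fin n) V) :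
    mnorm (c • x) ≤ ‖c‖ * mnorm x := by
  obtain ⟨H, _, _, ι, hι⟩ := hV.exists_rep
  rw [hι, hι, Matrix.map_smul _ _ (fun a => map_smul ι c a)]
  exact norm_matrixOperator_smul_le _ _

theorem mnorm_zero : mnorm (0 : Matrix (Fin n) (Fin n) V) = 0 := by
  have := mnorm_smul_le (V := V) 0 (0 : Matrix (Fin n) (Fin n) V)
  refine le_antisymm (by simpa using this) (mnorm_nonneg _)

theorem mnorm_smul (c : ℂ) (x : Matrix (Fin n) (Fin n) V) : mnorm (c • x) = ‖c‖ * mnorm x := by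
  refine le_antisymm (mnorm_smul_le c x) ?_
  rcases eq_or_ne c 0 with rfl | hc
  · simp [mnorm_zero]
  · have h := mnorm_smul_le c⁻¹ (c • x)
    rw [smul_smul, inv_mul_cancel₀ hc, one_smul, norm_inv] at h
    rwa [← le_inv_mul_iff₀ (norm_pos_iff.2 hc)]

theorem norm_entry_le_mnorm (x : Matrix (Fin n) (Fin n) V) (i j : Fin n) : ‖x i j‖ ≤ mnorm x := by
  obtain ⟨H, _, _, ι, hι⟩ := hV.exists_rep
  rw [hι, ← ι.norm_map (x i j)]
  exact norm_entry_le_norm_matrixOperator (x.map ι) i j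

theorem mnorm_eq_norm (x : Matrix (Fin 1) (Fin 1) V) : mnorm x = ‖x 0 0‖ := by
  obtain ⟨H, _, _, ι, hι⟩ := hV.exists_rep
  rw [hι, ← ι.norm_map (x 0 0), norm_matrixOperator_one]
  rfl

theorem eq_zero_of_mnorm_eq_zero {x : Matrix (Fin n) (Fin n) V} (h : mnorm x = 0) : x = 0 := by
  ext i j
  exact norm_le_zero_iff.1 (h ▸ norm_entry_le_mnorm x i j)

theorem mnorm_sub_comm (x y : Matrix (Fin n) (Fin n) V) : mnorm (x - y) = mnorm (y - x) := by
  have := mnorm_smul (-1) (y - x)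
  simpa using this

theorem mnorm_le_add_mnorm_sub (x y : Matrix (Fin n) (Fin n) V) :
    mnorm x ≤ mnorm y + mnorm (x - y) := by
  simpa using mnorm_add_le y (x - y)

theorem mnorm_sum_le {ι : Type*} (s : Finset ι) (x : ι → Matrix (Fin n) (Fin n) V) :
    mnorm (∑ i ∈ s, x i) ≤ ∑ i ∈ s, mnorm (x i) := by
  classical
  induction s using Finset.induction_on with
  | empty => simp [mnorm_zero]
  | insert a s ha ih =>
    rw [Finset.sum_insert ha, Finset.sum_insert ha]
    exact (mnorm_add_le _ _).trans (by gcongr)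

omit hW in
-- A bounded functional is completely bounded with the same constant. For `w = f(x) z` one has `‖w‖²
-- = f(y)` with `y = ∑ conj(w_i) z_j x_ij`, and Cauchy-Schwarz gives `‖y‖ ≤ ‖w‖ ‖x‖ ‖z‖`; one factor
-- `‖w‖` cancels.
theorem sum_norm_sq_functional_le (f : V →ₗ[ℂ] ℂ) {c : ℝ} (hc : 0 ≤ c)
    (hf : ∀ v, ‖f v‖ ≤ c * ‖v‖) (x : Matrix (Fin n) (Fin n) V) (z : Fin n → ℂ) :
    ∑ i, ‖∑ j, f (x i j) * z j‖ ^ 2 ≤ (c * mnorm x) ^ 2 * ∑ j, ‖z j‖ ^ 2 := by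
  obtain ⟨H, _, _, ι, hι⟩ := hV.exists_rep
  set w : Fin n → ℂ := fun i => ∑ j, f (x i j) * z j with hw
  set T : ℝ := ∑ i, ‖w i‖ ^ 2 with hT
  set Z : ℝ := ∑ j, ‖z j‖ ^ 2 with hZ
  have hT0 : 0 ≤ T := by positivity
  have hZ0 : 0 ≤ Z := by positivity
  set y : V := ∑ i, ∑ j, (starRingEnd ℂ (w i) * z j) • x i j with hy
  have hfy : ‖f y‖ = T := by
    have : f y = ((∑ i, ‖w i‖ ^ 2 : ℝ) : ℂ) := by
      rw [hy, map_sum]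
      push_cast
      refine Finset.sum_congr rfl fun i _ => ?_
      rw [← Complex.conj_mul', map_sum]
      conv_rhs => rw [hw]
      rw [Finset.mul_sum]
      refine Finset.sum_congr rfl fun j _ => ?_
      rw [map_smul, smul_eq_mul]; ring
    rw [this, Complex.norm_real, Real.norm_of_nonneg hT0]
  have hyn : ‖y‖ ≤ √T * (mnorm x * √Z) := by
    rw [← ι.norm_map]
    refine ContinuousLinearMap.opNorm_le_bound _ (by have := mnorm_nonneg x; positivity) fun h => ?_
    have e1 : ι y h = ∑ i, starRingEnd ℂ (w i) • ∑ j, (x.map ι) i j (z j • h) := by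
      simp [hy, map_sum, Finset.smul_sum, mul_smul]
    have e2 := sum_norm_sq_le_norm_matrixOperator (x.map ι) (fun j => z j • h)
    rw [← hι] at e2
    simp only [norm_smul, mul_pow, ← Finset.sum_mul] at e2
    rw [e1]
    calc _ ≤ ∑ i, ‖w i‖ * ‖∑ j, (x.map ι) i j (z j • h)‖ := by
          refine (norm_sum_le _ _).trans (Finset.sum_le_sum fun i _ => ?_)
          rw [norm_smul, RCLike.norm_conj]
      _ ≤ √T * √(∑ i, ‖∑ j, (x.map ι) i j (z j • h)‖ ^ 2) :=
          Real.sum_mul_le_sqrt_mul_sqrt _ _ _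
      _ ≤ √T * √((mnorm x * √Z * ‖h‖) ^ 2) := by
          gcongr
          rw [mul_pow, mul_pow, Real.sq_sqrt hZ0]
          linarith
      _ = _ := by
          rw [Real.sqrt_sq (by have := mnorm_nonneg x; positivity)]; ring
  have h1 : T ≤ √T * (c * mnorm x * √Z) := by
    calc T = ‖f y‖ := hfy.symm
      _ ≤ c * ‖y‖ := hf y
      _ ≤ c * (√T * (mnorm x * √Z)) := by gcongr
      _ = _ := by ring
  have h2 : √T ≤ c * mnorm x * √Z := by
    rcases eq_or_lt_of_le (Real.sqrt_nonneg T) with h0 | h0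
    · rw [← h0]; have := mnorm_nonneg x; positivity
    · refine le_of_mul_le_mul_left ?_ h0
      rwa [Real.mul_self_sqrt hT0]
  calc T = √T ^ 2 := (Real.sq_sqrt hT0).symm
    _ ≤ (c * mnorm x * √Z) ^ 2 := by gcongr
    _ = _ := by rw [mul_pow, Real.sq_sqrt hZ0]

/-- Rank one maps `v ↦ f(v) y` are completely bounded, with constant `‖f‖ ‖y‖`. -/
theorem mnorm_smulRight_le (f : V →ₗ[ℂ] ℂ) {c : ℝ} (hc : 0 ≤ c) (hf : ∀ v, ‖f v‖ ≤ c * ‖v‖)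
    (y : W) (x : Matrix (Fin n) (Fin n) V) :
    mnorm (x.map fun v => f v • y) ≤ c * ‖y‖ * mnorm x := by
  obtain ⟨K, _, _, ι, hι⟩ := hW.exists_rep
  have hx := mnorm_nonneg x
  rw [hι]
  refine norm_matrixOperator_le (by positivity) fun ξ => ?_
  have h := sum_norm_sq_smul_le (fun i j => f (x i j)) _
    (sum_norm_sq_functional_le f hc hf x) (fun j => ι y (ξ j))
  have e : ∀ i j, ((x.map fun v => f v • y).map ι) i j (ξ j) = f (x i j) • ι y (ξ j) := by
    intro i j; simp
  simp only [e]
  refine h.trans ?_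
  calc _ ≤ (c * mnorm x) ^ 2 * ∑ j, (‖y‖ * ‖ξ j‖) ^ 2 := by
        gcongr with j
        rw [← ι.norm_map y]
        exact (ι y).le_opNorm _
    _ = _ := by simp only [mul_pow, ← Finset.mul_sum]; ring

end Rank

/-! ### Completely bounded maps and distortion -/

section Bounds

variable {V W Z : Type u} [NormedAddCommGroup V] [NormedSpace ℂ V] [MatrixNorms V]
  [NormedAddCommGroup W] [NormedSpace ℂ W] [MatrixNorms W]
  [NormedAddCommGroup Z] [NormedSpace ℂ Z] [MatrixNorms Z]

/-- `‖u‖_cb ≤ a`. -/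
def CBLe (u : V →ₗ[ℂ] W) (a : ℝ) : Prop :=
  ∀ (n : ℕ) (x : Matrix (Fin n) (Fin n) V), mnorm (x.map u) ≤ a * mnorm x

/-- `‖u⁻¹‖_cb ≤ b`. -/
def CBGe (u : V →ₗ[ℂ] W) (b : ℝ) : Prop :=
  ∀ (n : ℕ) (x : Matrix (Fin n) (Fin n) V), mnorm x ≤ b * mnorm (x.map u)

/-- `D(u) ≤ C`. -/
def Distort (u : V →ₗ[ℂ] W) (C : ℝ) : Prop :=
  ∃ a b : ℝ, 0 < a ∧ 0 < b ∧ a * b ≤ C ∧ CBLe u a ∧ CBGe u b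

theorem CBLe.comp {v : W →ₗ[ℂ] Z} {u : V →ₗ[ℂ] W} {a a' : ℝ} (hv : CBLe v a') (hu : CBLe u a)
    (h0 : 0 ≤ a') : CBLe (v ∘ₗ u) (a' * a) := fun n x => by
  calc mnorm ((x.map u).map v) ≤ a' * mnorm (x.map u) := hv n _
    _ ≤ a' * (a * mnorm x) := by gcongr; exact hu n x
    _ = _ := by ring

theorem CBGe.comp {v : W →ₗ[ℂ] Z} {u : V →ₗ[ℂ] W} {b b' : ℝ} (hv : CBGe v b') (hu : CBGe u b)
    (h0 : 0 ≤ b) : CBGe (v ∘ₗ u) (b * b') := fun n x => by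
  calc mnorm x ≤ b * mnorm (x.map u) := hu n x
    _ ≤ b * (b' * mnorm ((x.map u).map v)) := by gcongr; exact hv n _
    _ = b * b' * mnorm ((x.map u).map v) := by ring

theorem Distort.comp {v : W →ₗ[ℂ] Z} {u : V →ₗ[ℂ] W} {C C' : ℝ} (hv : Distort v C')
    (hu : Distort u C) : Distort (v ∘ₗ u) (C' * C) := by
  obtain ⟨a, b, ha, hb, hab, h1, h2⟩ := hu
  obtain ⟨a', b', ha', hb', hab', h1', h2'⟩ := hv
  refine ⟨a' * a, b * b', by positivity, by positivity, ?_, h1'.comp h1 ha'.le, h2'.comp h2 hb.le⟩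
  calc a' * a * (b * b') = (a' * b') * (a * b) := by ring
    _ ≤ _ := by gcongr; exact (by positivity : 0 ≤ a' * b').trans hab'

theorem Distort.mono {u : V →ₗ[ℂ] W} {C C' : ℝ} (hu : Distort u C) (h : C ≤ C') :
    Distort u C' := by
  obtain ⟨a, b, ha, hb, hab, h1, h2⟩ := hu
  exact ⟨a, b, ha, hb, hab.trans h, h1, h2⟩

theorem CBGe.of_equiv {e : V ≃ₗ[ℂ] W} {b : ℝ} (h : CBGe (e : V →ₗ[ℂ] W) b) :
    CBLe (e.symm : W →ₗ[ℂ] V) b := fun n x => by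
  have := h n (x.map e.symm)
  simpa [Matrix.map_map, Function.comp_def] using this

theorem CBLe.of_equiv {e : V ≃ₗ[ℂ] W} {a : ℝ} (h : CBLe (e : V →ₗ[ℂ] W) a) :
    CBGe (e.symm : W →ₗ[ℂ] V) a := fun n x => by
  have := h n (x.map e.symm)
  simpa [Matrix.map_map, Function.comp_def] using this

theorem Distort.symm {e : V ≃ₗ[ℂ] W} {C : ℝ} (h : Distort (e : V →ₗ[ℂ] W) C) :
    Distort (e.symm : W →ₗ[ℂ] V) C := by
  obtain ⟨a, b, ha, hb, hab, h1, h2⟩ := h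
  exact ⟨b, a, hb, ha, by linarith, h2.of_equiv, h1.of_equiv⟩

theorem CBLe.id : CBLe (LinearMap.id : V →ₗ[ℂ] V) 1 := fun n x => by
  simp [Matrix.map_id]

theorem CBGe.id : CBGe (LinearMap.id : V →ₗ[ℂ] V) 1 := fun n x => by
  simp [Matrix.map_id]

theorem CBLe.subtype (S : Submodule ℂ V) : CBLe S.subtype 1 := fun _ _ => (one_mul _).ge

theorem CBGe.subtype (S : Submodule ℂ V) : CBGe S.subtype 1 := fun _ _ => (one_mul _).ge

theorem CBLe.inclusion {S T : Submodule ℂ V} (h : S ≤ T) : CBLe (Submodule.inclusion h) 1 :=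
  fun _ _ => (one_mul _).ge

theorem CBGe.inclusion {S T : Submodule ℂ V} (h : S ≤ T) : CBGe (Submodule.inclusion h) 1 :=
  fun _ _ => (one_mul _).ge

theorem isCompleteIsometry_iff {u : V →ₗ[ℂ] W} : IsCompleteIsometry u ↔ CBLe u 1 ∧ CBGe u 1 := by
  simp only [IsCompleteIsometry, CBLe, CBGe, one_mul]
  exact ⟨fun h => ⟨fun n x => (h n x).le, fun n x => (h n x).ge⟩,
    fun h n x => le_antisymm (h.1 n x) (h.2 n x)⟩

variable [ConcreteNorms V] [ConcreteNorms W] [ConcreteNorms Z]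

theorem CBLe.norm_le {u : V →ₗ[ℂ] W} {a : ℝ} (hu : CBLe u a) (x : V) : ‖u x‖ ≤ a * ‖x‖ := by
  have := hu 1 (Matrix.of fun _ _ => x)
  rw [mnorm_eq_norm, mnorm_eq_norm] at this
  exact this

theorem CBGe.le_norm {u : V →ₗ[ℂ] W} {b : ℝ} (hu : CBGe u b) (x : V) : ‖x‖ ≤ b * ‖u x‖ := by
  have := hu 1 (Matrix.of fun _ _ => x)
  rw [mnorm_eq_norm, mnorm_eq_norm] at this
  exact this

theorem CBGe.injective {u : V →ₗ[ℂ] W} {b : ℝ} (hu : CBGe u b) : Function.Injective u := by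
  refine (injective_iff_map_eq_zero u).2 fun x hx => ?_
  have := hu.le_norm x
  simpa [hx] using this

theorem Distort.injective {u : V →ₗ[ℂ] W} {C : ℝ} (hu : Distort u C) : Function.Injective u := by
  obtain ⟨a, b, ha, hb, hab, h1, h2⟩ := hu
  exact h2.injective

theorem CBLe.mono {u : V →ₗ[ℂ] W} {a a' : ℝ} (hu : CBLe u a) (h : a ≤ a') : CBLe u a' :=
  fun n x => (hu n x).trans (by have := mnorm_nonneg x; gcongr)

theorem CBGe.mono {u : V →ₗ[ℂ] W} {b b' : ℝ} (hu : CBGe u b) (h : b ≤ b') : CBGe u b' :=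
  fun n x => (hu n x).trans (by have := mnorm_nonneg (x.map u); gcongr)

theorem CBLe.add {u v : V →ₗ[ℂ] W} {a a' : ℝ} (hu : CBLe u a) (hv : CBLe v a') :
    CBLe (u + v) (a + a') := fun n x => by
  have : x.map (u + v) = x.map u + x.map v := rfl
  rw [this, add_mul]
  exact (mnorm_add_le _ _).trans (add_le_add (hu n x) (hv n x))

theorem CBLe.sub_comm {u v : V →ₗ[ℂ] W} {a : ℝ} (h : CBLe (u - v) a) : CBLe (v - u) a :=
  fun n x => by
  have h1 : x.map (u - v) = x.map u - x.map v := rfl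
  have h2 : x.map (v - u) = x.map v - x.map u := rfl
  rw [h2, mnorm_sub_comm, ← h1]
  exact h n x

theorem CBLe.smul {u : V →ₗ[ℂ] W} {a : ℝ} (hu : CBLe u a) (c : ℂ) :
    CBLe (c • u) (‖c‖ * a) := fun n x => by
  have : x.map (c • u) = c • x.map u := rfl
  rw [this, mnorm_smul, mul_assoc]
  gcongr
  exact hu n x

theorem CBGe.smul {u : V →ₗ[ℂ] W} {b : ℝ} (hu : CBGe u b) {c : ℂ} (hc : c ≠ 0) :
    CBGe (c • u) (b / ‖c‖) := fun n x => by
  have : x.map (c • u) = c • x.map u := rfl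
  have hc' : ‖c‖ ≠ 0 := by simpa using hc
  rw [this, mnorm_smul, ← mul_assoc, div_mul_cancel₀ _ hc']
  exact hu n x

/-- A map close to an isomorphism onto its range has nearly the same bounds. -/
theorem bounds_of_close {u v : V →ₗ[ℂ] W} {a b q η : ℝ} (hq : 1 < q) (hb : 0 < b)
    (h1 : CBLe u a) (h2 : CBGe u b) (ha : η ≤ (q - 1) * a) (hη : η * b ≤ 1 - q⁻¹)
    (h : CBLe (v - u) η) : CBLe v (q * a) ∧ CBGe v (q * b) := by
  constructor
  · have := (h1.add h).mono (show a + η ≤ q * a by linarith)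
    simpa using this
  · intro n x
    have e1 : mnorm (x.map u) ≤ mnorm (x.map v) + η * mnorm x :=
      (mnorm_le_add_mnorm_sub (x.map u) (x.map v)).trans
        (by gcongr; exact h.sub_comm n x)
    have e2 := h2 n x
    have e3 := mnorm_nonneg x
    have e4 : mnorm x ≤ b * mnorm (x.map v) + (1 - q⁻¹) * mnorm x := by
      calc mnorm x ≤ b * (mnorm (x.map v) + η * mnorm x) := e2.trans (by gcongr)
        _ = b * mnorm (x.map v) + (η * b) * mnorm x := by ring
        _ ≤ _ := by gcongr
    have e5 : q⁻¹ * mnorm x ≤ b * mnorm (x.map v) := by linarith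
    rw [inv_mul_le_iff₀ (by linarith)] at e5
    linarith

theorem cbNorm_le_iff {u : V →ₗ[ℂ] W} {a : ℝ} (ha : 0 ≤ a) :
    cbNorm u ≤ ENNReal.ofReal a ↔ CBLe u a := by
  simp only [cbNorm, iSup_le_iff, CBLe]
  constructor
  · intro h n x
    rcases (mnorm_nonneg x).eq_or_lt with h0 | h0
    · have := eq_zero_of_mnorm_eq_zero h0.symm
      subst this
      have e : (0 : Matrix (Fin n) (Fin n) V).map u = 0 := by ext; simp
      rw [e, mnorm_zero, mnorm_zero, mul_zero]
    · set c : ℂ := (((mnorm x)⁻¹ : ℝ) : ℂ) with hc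
      have hcn : ‖c‖ = (mnorm x)⁻¹ := by
        rw [hc, Complex.norm_real, Real.norm_of_nonneg (by positivity)]
      have e : (c • x).map u = c • x.map u := Matrix.map_smul _ _ (fun a => map_smul u c a) _
      have := h n (c • x) (by rw [mnorm_smul, hcn, inv_mul_cancel₀ h0.ne'])
      rw [ENNReal.ofReal_le_ofReal_iff ha, e, mnorm_smul, hcn, inv_mul_le_iff₀ h0] at this
      linarith
  · intro h n x hx
    refine ENNReal.ofReal_le_ofReal ((h n x).trans ?_)
    nlinarith

theorem cbNormInv_le_iff {u : V →ₗ[ℂ] W} (hu : Function.Injective u) {b : ℝ} (hb : 0 ≤ b) :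
    cbNormInv u hu ≤ ENNReal.ofReal b ↔ CBGe u b := by
  unfold cbNormInv
  have hs : ∀ x, (LinearEquiv.ofInjective u hu).symm ⟨u x, x, rfl⟩ = x := fun x =>
    (LinearEquiv.ofInjective u hu).symm_apply_apply x
  rw [cbNorm_le_iff hb]
  constructor
  · intro h n x
    have := h n (fun i j => ⟨u (x i j), x i j, rfl⟩)
    have e : x = Matrix.map (fun i j => (⟨u (x i j), x i j, rfl⟩ : LinearMap.range u))
        (LinearEquiv.ofInjective u hu).symm := by
      ext i j
      exact (hs _).symm
    calc mnorm x = _ := congrArg mnorm e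
      _ ≤ _ := this
  · intro h n y
    have := h n (y.map (LinearEquiv.ofInjective u hu).symm)
    have e : y.map (fun s => (s : W)) = (y.map (LinearEquiv.ofInjective u hu).symm).map u := by
      ext i j
      exact congrArg Subtype.val ((LinearEquiv.ofInjective u hu).apply_symm_apply (y i j)).symm
    calc _ ≤ _ := this
      _ = b * mnorm (y.map (fun s => (s : W))) := by rw [e]

theorem isEpsEmbedding_iff {u : V →ₗ[ℂ] W} {ε : ℝ} (hε : 0 ≤ ε) :
    IsEpsEmbedding ε u ↔ CBLe u (1 + ε) ∧ CBGe u (1 + ε) := by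
  constructor
  · rintro ⟨hu, h1, h2⟩
    exact ⟨(cbNorm_le_iff (by linarith)).1 h1, (cbNormInv_le_iff hu (by linarith)).1 h2⟩
  · rintro ⟨h1, h2⟩
    exact ⟨h2.injective, (cbNorm_le_iff (by linarith)).2 h1,
      (cbNormInv_le_iff h2.injective (by linarith)).2 h2⟩

/-- The map is a sum of rank one maps `v ↦ e_i^*(v) u(e_i)`, one for each basis vector. Cb estimates
on finite-dimensional spaces thus reduce to values on a basis. -/
theorem cbLe_sum_basis {ι : Type*} [Fintype ι] [FiniteDimensional ℂ V] (e : Module.Basis ι ℂ V)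
    (u : V →ₗ[ℂ] W) :
    CBLe u (∑ i, ‖(e.coord i).toContinuousLinearMap‖ * ‖u (e i)‖) := fun n x => by
  have h : x.map u = ∑ i, x.map (fun v => e.coord i v • u (e i)) := by
    ext k l
    rw [Matrix.map_apply, Matrix.sum_apply]
    conv_lhs => rw [← e.sum_repr (x k l), map_sum]
    simp
  rw [h, Finset.sum_mul]
  refine (mnorm_sum_le _ _).trans (Finset.sum_le_sum fun i _ => ?_)
  exact mnorm_smulRight_le _ (norm_nonneg _)
    (fun v => (e.coord i).toContinuousLinearMap.le_opNorm v) _ _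

variable (V) in
/-- On a finite-dimensional space the completely bounded norm is controlled by the norm. -/
theorem exists_cbLe_of_norm_le [FiniteDimensional ℂ V] :
    ∃ C : ℝ, 0 < C ∧ ∀ (W : Type u) [NormedAddCommGroup W] [NormedSpace ℂ W] [MatrixNorms W]
      [ConcreteNorms W] (u : V →ₗ[ℂ] W) (r : ℝ), 0 ≤ r → (∀ x, ‖u x‖ ≤ r * ‖x‖) →
        CBLe u (C * r) := by
  let e := Module.finBasis ℂ V
  -- The constant involves only the basis of `V`, so it serves all targets at once. This matters
  -- when the target is a stage `L n` whose index is still to be chosen.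
  refine ⟨1 + ∑ i, ‖(e.coord i).toContinuousLinearMap‖ * ‖e i‖, by positivity, ?_⟩
  intro W _ _ _ _ u r hr hu
  refine (cbLe_sum_basis e u).mono ?_
  rw [add_mul, one_mul, Finset.sum_mul]
  have : ∑ i, ‖(e.coord i).toContinuousLinearMap‖ * ‖u (e i)‖ ≤
      ∑ i, ‖(e.coord i).toContinuousLinearMap‖ * ‖e i‖ * r := by
    refine Finset.sum_le_sum fun i _ => ?_
    rw [mul_assoc]
    gcongr
    exact (hu _).trans_eq (mul_comm _ _)
  linarith

theorem exists_cbLe [FiniteDimensional ℂ V] (u : V →ₗ[ℂ] W) : ∃ a : ℝ, 0 < a ∧ CBLe u a :=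
  ⟨_, lt_add_of_pos_of_le one_pos
    (by positivity : 0 ≤ ∑ i, ‖((Module.finBasis ℂ V).coord i).toContinuousLinearMap‖ *
      ‖u (Module.finBasis ℂ V i)‖),
    (cbLe_sum_basis _ u).mono (by linarith)⟩

theorem exists_cbGe [FiniteDimensional ℂ V] (u : V →ₗ[ℂ] W) (hu : Function.Injective u) :
    ∃ b : ℝ, 0 < b ∧ CBGe u b := by
  have : FiniteDimensional ℂ (LinearMap.range u) := LinearMap.finiteDimensional_range u
  obtain ⟨b, hb, h⟩ := exists_cbLe ((LinearEquiv.ofInjective u hu).symm : LinearMap.range u →ₗ[ℂ] V)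
  refine ⟨b, hb, ?_⟩
  rw [← cbNormInv_le_iff hu hb.le]
  exact (cbNorm_le_iff hb.le).2 h

theorem Distort.distortion_le {u : V →ₗ[ℂ] W} {C : ℝ} (h : Distort u C) (hC : 1 ≤ C)
    (hu : Function.Injective u) : distortion u hu ≤ ENNReal.ofReal C := by
  obtain ⟨a, b, ha, hb, hab, h1, h2⟩ := h
  refine max_le (by simpa using hC) ?_
  calc _ ≤ ENNReal.ofReal a * ENNReal.ofReal b :=
        mul_le_mul' ((cbNorm_le_iff ha.le).2 h1) ((cbNormInv_le_iff hu hb.le).2 h2)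
    _ = ENNReal.ofReal (a * b) := (ENNReal.ofReal_mul ha.le).symm
    _ ≤ _ := ENNReal.ofReal_le_ofReal hab

/-- Passage from extended values to real constants: in finite dimension both cb norms are finite,
and they are nonzero unless `V = 0`. -/
theorem distort_toReal [FiniteDimensional ℂ V] {u : V →ₗ[ℂ] W} (hu : Function.Injective u) :
    distortion u hu ≠ ⊤ ∧ 1 ≤ (distortion u hu).toReal ∧
      Distort u (distortion u hu).toReal := by
  obtain ⟨a, ha, h1⟩ := exists_cbLe u
  obtain ⟨b, hb, h2⟩ := exists_cbGe u hu
  have t1 : cbNorm u ≠ ⊤ := ne_top_of_le_ne_top ENNReal.ofReal_ne_top ((cbNorm_le_iff ha.le).2 h1)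
  have t2 : cbNormInv u hu ≠ ⊤ :=
    ne_top_of_le_ne_top ENNReal.ofReal_ne_top ((cbNormInv_le_iff hu hb.le).2 h2)
  have t : distortion u hu ≠ ⊤ := by
    simp only [distortion, ne_eq, max_eq_top, ENNReal.one_ne_top, false_or]
    exact ENNReal.mul_ne_top t1 t2
  have l1 : 1 ≤ (distortion u hu).toReal := by
    rw [← ENNReal.toReal_one]
    exact ENNReal.toReal_mono t (le_max_left _ _)
  refine ⟨t, l1, ?_⟩
  have k1 : CBLe u (cbNorm u).toReal :=
    (cbNorm_le_iff ENNReal.toReal_nonneg).1 (ENNReal.ofReal_toReal t1).ge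
  have k2 : CBGe u (cbNormInv u hu).toReal :=
    (cbNormInv_le_iff hu ENNReal.toReal_nonneg).1 (ENNReal.ofReal_toReal t2).ge
  rcases subsingleton_or_nontrivial V with hV | hV
  -- On the zero space both cb norms vanish, and positive constants have to be supplied by hand.
  · refine ⟨1, 1, one_pos, one_pos, by simpa using l1, ?_, ?_⟩
    · intro n x
      have : x.map u = 0 := by ext i j; simp [Subsingleton.elim (x i j) 0]
      rw [this, mnorm_zero, one_mul]; exact mnorm_nonneg x
    · intro n x
      have : x = 0 := Subsingleton.elim _ _
      rw [this, mnorm_zero, one_mul]; exact mnorm_nonneg _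
  · obtain ⟨x, hx⟩ := exists_ne (0 : V)
    have hx' : 0 < ‖x‖ := norm_pos_iff.2 hx
    have hux : 0 < ‖u x‖ := norm_pos_iff.2 fun h => hx (hu (by simpa using h))
    refine ⟨_, _, ?_, ?_, ?_, k1, k2⟩
    · by_contra hneg
      have := k1.norm_le x
      nlinarith
    · by_contra hneg
      have := k2.le_norm x
      nlinarith
    · rw [← ENNReal.toReal_mul]
      exact ENNReal.toReal_mono t (le_max_right _ _)

theorem Distort.of_distortion_le [FiniteDimensional ℂ V] {u : V →ₗ[ℂ] W} {C : ℝ}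
    (hu : Function.Injective u) (hC : 0 ≤ C) (h : distortion u hu ≤ ENNReal.ofReal C) :
    Distort u C :=
  (distort_toReal hu).2.2.mono (ENNReal.toReal_le_of_le_ofReal hC h)

/-- Two-sided bounds from a bound on the distortion and the size at one vector. -/
theorem Distort.bounds {u : V →ₗ[ℂ] W} {C s : ℝ} (h : Distort u C) (hs : 0 < s) {x : V}
    (hx : x ≠ 0) (h1 : ‖u x‖ ≤ s * ‖x‖) (h2 : ‖x‖ ≤ s * ‖u x‖) :
    CBLe u (C * s) ∧ CBGe u (C * s) := by
  obtain ⟨a, b, ha, hb, hab, k1, k2⟩ := h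
  have hx' : 0 < ‖x‖ := norm_pos_iff.2 hx
  have e1 := k1.norm_le x
  have e2 := k2.le_norm x
  -- The vector `x` shows that neither `a` nor `b` lies below `1 / s`; hence each of them is at most
  -- `a * b * s`.
  have b1 : 1 ≤ b * s := by
    refine le_of_mul_le_mul_right ?_ hx'
    calc 1 * ‖x‖ ≤ b * ‖u x‖ := by simpa using e2
      _ ≤ b * (s * ‖x‖) := by gcongr
      _ = _ := by ring
  have a1 : 1 ≤ a * s := by
    refine le_of_mul_le_mul_right ?_ hx'
    calc 1 * ‖x‖ ≤ s * ‖u x‖ := by simpa using h2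
      _ ≤ s * (a * ‖x‖) := by gcongr
      _ = _ := by ring
  refine ⟨k1.mono ?_, k2.mono ?_⟩
  · calc a = a * 1 := by ring
      _ ≤ a * (b * s) := by gcongr
      _ = a * b * s := by ring
      _ ≤ _ := by gcongr
  · calc b = b * 1 := by ring
      _ ≤ b * (a * s) := by gcongr
      _ = a * b * s := by ring
      _ ≤ _ := by gcongr

theorem distort_of_bounds {u : V →ₗ[ℂ] W} {a b : ℝ} (ha : 0 < a) (hb : 0 < b) (h1 : CBLe u a)
    (h2 : CBGe u b) : Distort u (a * b) :=
  ⟨a, b, ha, hb, le_rfl, h1, h2⟩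

end Bounds

/-! ### Ultraproducts of Hilbert spaces -/

section Ultraproduct

/-- The limit of a sequence along a fixed free ultrafilter. -/
def ultraLim {E : Type*} [TopologicalSpace E] [Nonempty E] (f : ℕ → E) : E :=
  limUnder (hyperfilter ℕ : Filter ℕ) f

theorem tendsto_ultraLim {E : Type*} [NormedAddCommGroup E] [ProperSpace E] {f : ℕ → E}
    (hf : ∃ C, ∀ n, ‖f n‖ ≤ C) : Tendsto f (hyperfilter ℕ : Filter ℕ) (𝓝 (ultraLim f)) := by
  obtain ⟨C, hC⟩ := hf
  obtain ⟨x, -, hx⟩ := (isCompact_closedBall (0 : E) C).ultrafilter_le_nhds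
    ((hyperfilter ℕ).map f) (by
      rw [Ultrafilter.coe_map, le_principal_iff, mem_map]
      exact univ_mem' fun n => by simpa using hC n)
  exact tendsto_nhds_limUnder ⟨x, hx⟩

variable (H : ℕ → Type u) [∀ n, NormedAddCommGroup (H n)] [∀ n, InnerProductSpace ℂ (H n)]

/-- The bounded sequences in a product of Hilbert spaces, as a subspace. -/
def boundedSeqSubmodule : Submodule ℂ (∀ n, H n) where
  carrier := {ξ | ∃ C, ∀ n, ‖ξ n‖ ≤ C}
  add_mem' := by
    rintro ξ η ⟨C, hC⟩ ⟨D, hD⟩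
    exact ⟨C + D, fun n => (norm_add_le _ _).trans (add_le_add (hC n) (hD n))⟩
  zero_mem' := ⟨0, fun n => by simp⟩
  smul_mem' := by
    rintro c ξ ⟨C, hC⟩
    exact ⟨‖c‖ * C, fun n => by
      rw [Pi.smul_apply, norm_smul]; gcongr; exact hC n⟩

/-- The bounded sequences, with the seminorm given by the limit along the ultrafilter. -/
def BoundedSeq : Type u := boundedSeqSubmodule H

namespace BoundedSeq

instance : AddCommGroup (BoundedSeq H) := inferInstanceAs (AddCommGroup (boundedSeqSubmodule H))

instance : Module ℂ (BoundedSeq H) := inferInstanceAs (Module ℂ (boundedSeqSubmodule H))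

variable {H}

/-- The terms of a bounded sequence. -/
def term (ξ : BoundedSeq H) (n : ℕ) : H n := ξ.1 n

theorem exists_bound (ξ : BoundedSeq H) : ∃ C, ∀ n, ‖ξ.term n‖ ≤ C := ξ.2

/-- A bounded sequence from its terms. -/
def mk (f : ∀ n, H n) (h : ∃ C, ∀ n, ‖f n‖ ≤ C) : BoundedSeq H := ⟨f, h⟩

@[simp] theorem term_mk (f : ∀ n, H n) (h : ∃ C, ∀ n, ‖f n‖ ≤ C) (n : ℕ) :
    (mk f h).term n = f n := rfl

@[simp] theorem term_add (ξ η : BoundedSeq H) (n : ℕ) : (ξ + η).term n = ξ.term n + η.term n := rfl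

@[simp] theorem term_smul (c : ℂ) (ξ : BoundedSeq H) (n : ℕ) : (c • ξ).term n = c • ξ.term n := rfl

@[simp] theorem term_zero (n : ℕ) : (0 : BoundedSeq H).term n = 0 := rfl

@[ext] theorem ext {ξ η : BoundedSeq H} (h : ∀ n, ξ.term n = η.term n) : ξ = η :=
  Subtype.ext (funext h)

theorem term_sum {ι : Type*} (s : Finset ι) (ξ : ι → BoundedSeq H) (n : ℕ) :
    (∑ i ∈ s, ξ i).term n = ∑ i ∈ s, (ξ i).term n := by
  classical
  induction s using Finset.induction_on with
  | empty => simp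
  | insert a s ha ih => simp [Finset.sum_insert ha, ih]

theorem tendsto_inner_aux (ξ η : BoundedSeq H) :
    Tendsto (fun n => inner ℂ (ξ.term n) (η.term n)) (hyperfilter ℕ : Filter ℕ)
      (𝓝 (ultraLim fun n => inner ℂ (ξ.term n) (η.term n))) := by
  obtain ⟨C, hC⟩ := ξ.exists_bound
  obtain ⟨D, hD⟩ := η.exists_bound
  refine tendsto_ultraLim ⟨C * D, fun n => (norm_inner_le_norm _ _).trans ?_⟩
  exact mul_le_mul (hC n) (hD n) (norm_nonneg _) ((norm_nonneg _).trans (hC n))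

variable (H) in
/-- The semi-inner product on bounded sequences. -/
@[reducible] def core : PreInnerProductSpace.Core ℂ (BoundedSeq H) where
  inner ξ η := ultraLim fun n => inner ℂ (ξ.term n) (η.term n)
  conj_inner_symm ξ η := by
    refine tendsto_nhds_unique ?_ (tendsto_inner_aux ξ η)
    have := (Complex.continuous_conj.tendsto _).comp (tendsto_inner_aux η ξ)
    refine this.congr fun n => ?_
    exact inner_conj_symm _ _
  re_inner_nonneg ξ := by
    have := (Complex.continuous_re.tendsto _).comp (tendsto_inner_aux ξ ξ)
    exact ge_of_tendsto' this fun n => inner_self_nonneg (𝕜 := ℂ)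
  add_left ξ η ζ := by
    refine tendsto_nhds_unique (tendsto_inner_aux _ _) ?_
    refine ((tendsto_inner_aux ξ ζ).add (tendsto_inner_aux η ζ)).congr fun n => ?_
    simp
  smul_left ξ η c := by
    refine tendsto_nhds_unique (tendsto_inner_aux _ _) ?_
    refine ((tendsto_inner_aux ξ η).const_mul _).congr fun n => ?_
    simp [mul_comm]

instance : SeminormedAddCommGroup (BoundedSeq H) :=
  @InnerProductSpace.Core.toSeminormedAddCommGroup ℂ _ _ _ _ (core H)

instance : InnerProductSpace ℂ (BoundedSeq H) := InnerProductSpace.ofCore (core H)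

theorem tendsto_inner (ξ η : BoundedSeq H) :
    Tendsto (fun n => inner ℂ (ξ.term n) (η.term n)) (hyperfilter ℕ : Filter ℕ)
      (𝓝 (inner ℂ ξ η)) :=
  tendsto_inner_aux ξ η

theorem tendsto_norm_sq (ξ : BoundedSeq H) :
    Tendsto (fun n => ‖ξ.term n‖ ^ 2) (hyperfilter ℕ : Filter ℕ) (𝓝 (‖ξ‖ ^ 2)) := by
  have := (Complex.continuous_re.tendsto _).comp (tendsto_inner ξ ξ)
  have e : ∀ {E : Type u} [SeminormedAddCommGroup E] [InnerProductSpace ℂ E] (x : E),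
      Complex.re (inner ℂ x x) = ‖x‖ ^ 2 := fun x => inner_self_eq_norm_sq (𝕜 := ℂ) x
  rw [e] at this
  exact this.congr fun n => e _

/-- The map on bounded sequences given by a bounded sequence of operators. -/
def mapₗ (T : ∀ n, H n →L[ℂ] H n) (hT : ∃ C, ∀ n, ‖T n‖ ≤ C) : BoundedSeq H →ₗ[ℂ] BoundedSeq H where
  toFun ξ := mk (fun n => T n (ξ.term n)) <| by
    obtain ⟨C, hC⟩ := hT
    obtain ⟨D, hD⟩ := ξ.exists_bound
    exact ⟨C * D, fun n => ((T n).le_opNorm _).trans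
      (mul_le_mul (hC n) (hD n) (norm_nonneg _) ((norm_nonneg _).trans (hC n)))⟩
  map_add' ξ η := by ext n; simp
  map_smul' c ξ := by ext n; simp

theorem exists_bound_map (T : ∀ n, H n →L[ℂ] H n) (hT : ∃ C, ∀ n, ‖T n‖ ≤ C) :
    ∃ C, ∀ ξ, ‖mapₗ T hT ξ‖ ≤ C * ‖ξ‖ := by
  obtain ⟨C, hC⟩ := hT
  have hC0 : 0 ≤ C := (norm_nonneg _).trans (hC 0)
  refine ⟨C, fun ξ => le_of_sq_le_sq ?_ (by positivity)⟩
  rw [mul_pow]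
  refine le_of_tendsto_of_tendsto' (tendsto_norm_sq _) ((tendsto_norm_sq ξ).const_mul _) fun n => ?_
  rw [← mul_pow]
  exact pow_le_pow_left₀ (norm_nonneg _)
    (((T n).le_opNorm _).trans (mul_le_mul_of_nonneg_right (hC n) (norm_nonneg _))) 2

/-- The operator on bounded sequences given by a bounded sequence of operators. -/
def map (T : ∀ n, H n →L[ℂ] H n) (hT : ∃ C, ∀ n, ‖T n‖ ≤ C) : BoundedSeq H →L[ℂ] BoundedSeq H :=
  LinearMap.mkContinuousOfExistsBound (mapₗ T hT) (exists_bound_map T hT)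

@[simp] theorem term_map (T : ∀ n, H n →L[ℂ] H n) (hT : ∃ C, ∀ n, ‖T n‖ ≤ C) (ξ : BoundedSeq H)
    (n : ℕ) : (map T hT ξ).term n = T n (ξ.term n) := rfl

end BoundedSeq

/-- The Hilbert space ultraproduct. -/
abbrev UltraHilbert : Type u := UniformSpace.Completion (BoundedSeq H)

variable {H}

/-- The operator on the ultraproduct given by a bounded sequence of operators. -/
def ultraOp (T : ∀ n, H n →L[ℂ] H n) (hT : ∃ C, ∀ n, ‖T n‖ ≤ C) :
    UltraHilbert H →L[ℂ] UltraHilbert H :=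
  (BoundedSeq.map T hT).completion

theorem ultraOp_coe (T : ∀ n, H n →L[ℂ] H n) (hT : ∃ C, ∀ n, ‖T n‖ ≤ C) (ξ : BoundedSeq H) :
    ultraOp T hT (ξ : UltraHilbert H) = (BoundedSeq.map T hT ξ : BoundedSeq H) :=
  ContinuousLinearMap.completion_apply_coe _ _

theorem ultraOp_ext {S T : UltraHilbert H →L[ℂ] UltraHilbert H}
    (h : ∀ ξ : BoundedSeq H, S ξ = T ξ) : S = T := by
  ext x
  induction x using UniformSpace.Completion.induction_on with
  | hp => exact isClosed_eq S.continuous T.continuous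
  | ih ξ => exact h ξ

/-- Sequences of operators that agree eventually define the same operator. -/
theorem ultraOp_congr {S T : ∀ n, H n →L[ℂ] H n} (hS : ∃ C, ∀ n, ‖S n‖ ≤ C)
    (hT : ∃ C, ∀ n, ‖T n‖ ≤ C) (h : ∀ᶠ n in atTop, S n = T n) : ultraOp S hS = ultraOp T hT := by
  refine ultraOp_ext fun ξ => ?_
  rw [ultraOp_coe, ultraOp_coe, ← sub_eq_zero, ← norm_eq_zero, ← UniformSpace.Completion.coe_sub,
    UniformSpace.Completion.norm_coe]
  have h' : ∀ᶠ n in (hyperfilter ℕ : Filter ℕ), S n = T n :=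
    (Nat.hyperfilter_le_atTop : (hyperfilter ℕ : Filter ℕ) ≤ atTop) h
  have h2 := BoundedSeq.tendsto_norm_sq (BoundedSeq.map S hS ξ - BoundedSeq.map T hT ξ)
  have h3 : Tendsto (fun n => ‖(BoundedSeq.map S hS ξ - BoundedSeq.map T hT ξ).term n‖ ^ 2)
      (hyperfilter ℕ : Filter ℕ) (𝓝 0) := by
    refine tendsto_const_nhds.congr' (h'.mono fun n hn => ?_)
    change 0 = ‖S n (ξ.term n) - T n (ξ.term n)‖ ^ 2
    simp [hn]
  simpa using tendsto_nhds_unique h2 h3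

variable {k : ℕ}

theorem coe_sum_ultra {ι : Type*} (s : Finset ι) (ξ : ι → BoundedSeq H) :
    ((∑ i ∈ s, ξ i : BoundedSeq H) : UltraHilbert H) = ∑ i ∈ s, (ξ i : UltraHilbert H) :=
  map_sum (UniformSpace.Completion.toComplₗᵢ (𝕜 := ℂ) (E := BoundedSeq H)) ξ s

/-- Matrix norms of ultraproducts of operators, upper bound. -/
theorem norm_matrix_ultraOp_le (T : Fin k → Fin k → ∀ n, H n →L[ℂ] H n)
    (hT : ∀ i j, ∃ C, ∀ n, ‖T i j n‖ ≤ C) {M : ℝ} (hM : 0 ≤ M)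
    (h : ∀ᶠ n in atTop, ‖matrixOperator (Matrix.of fun i j => T i j n)‖ ≤ M) :
    ‖matrixOperator (Matrix.of fun i j => ultraOp (T i j) (hT i j))‖ ≤ M := by
  refine norm_matrixOperator_le hM fun ξ => ?_
  have hd : DenseRange (Pi.map fun (_ : Fin k) (x : BoundedSeq H) => (x : UltraHilbert H)) :=
    DenseRange.piMap fun _ => UniformSpace.Completion.denseRange_coe
  refine hd.induction_on (p := fun ξ => ∑ i, ‖∑ j, (Matrix.of fun i j => ultraOp (T i j) (hT i j))
    i j (ξ j)‖ ^ 2 ≤ M ^ 2 * ∑ j, ‖ξ j‖ ^ 2) ξ ?_ ?_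
  · refine isClosed_le ?_ ?_ <;> fun_prop
  · intro ξ
    simp only [Pi.map_apply, Matrix.of_apply, ultraOp_coe, ← coe_sum_ultra,
      UniformSpace.Completion.norm_coe]
    refine le_of_tendsto_of_tendsto (tendsto_finsetSum _ fun i _ => BoundedSeq.tendsto_norm_sq _)
      ((tendsto_finsetSum _ fun i _ => BoundedSeq.tendsto_norm_sq _).const_mul _) ?_
    filter_upwards [(Nat.hyperfilter_le_atTop : (hyperfilter ℕ : Filter ℕ) ≤ atTop) h] with n hn
    simp only [BoundedSeq.term_sum, BoundedSeq.term_map]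
    refine (sum_norm_sq_le_norm_matrixOperator (Matrix.of fun i j => T i j n) _).trans ?_
    have := norm_matrixOperator_nonneg (Matrix.of fun i j => T i j n)
    gcongr

/-- Matrix norms of ultraproducts of operators, lower bound. -/
theorem le_norm_matrix_ultraOp (T : Fin k → Fin k → ∀ n, H n →L[ℂ] H n)
    (hT : ∀ i j, ∃ C, ∀ n, ‖T i j n‖ ≤ C) {M : ℝ}
    (h : ∀ᶠ n in atTop, M ≤ ‖matrixOperator (Matrix.of fun i j => T i j n)‖) :
    M ≤ ‖matrixOperator (Matrix.of fun i j => ultraOp (T i j) (hT i j))‖ := by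
  by_contra! hlt
  obtain ⟨M', h1, h2⟩ := exists_between hlt
  have hM' : 0 ≤ M' := (norm_matrixOperator_nonneg _).trans h1.le
  -- vectors that witness the norms
  have hex : ∀ n, ∃ ξ : Fin k → H n, ∑ j, ‖ξ j‖ ^ 2 ≤ 1 ∧
      (M ≤ ‖matrixOperator (Matrix.of fun i j => T i j n)‖ →
        M' ^ 2 ≤ ∑ i, ‖∑ j, T i j n (ξ j)‖ ^ 2) := by
    intro n
    by_cases hn : M ≤ ‖matrixOperator (Matrix.of fun i j => T i j n)‖
    · have : ¬ ∀ ξ : Fin k → H n, ∑ i, ‖∑ j, (Matrix.of fun i j => T i j n) i j (ξ j)‖ ^ 2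
          ≤ M' ^ 2 * ∑ j, ‖ξ j‖ ^ 2 := fun hc =>
        absurd (norm_matrixOperator_le hM' hc) (not_le.2 (h2.trans_le hn))
      push Not at this
      obtain ⟨ξ, hξ⟩ := this
      set s := ∑ j, ‖ξ j‖ ^ 2 with hs
      have hs0 : 0 ≤ s := by positivity
      have hspos : 0 < s := by
        refine hs0.lt_of_ne' fun h0 => ?_
        have hz : ∀ j, ξ j = 0 := fun j => by
          have := (Finset.sum_eq_zero_iff_of_nonneg (fun j _ => by positivity)).1
            (hs.symm.trans h0) j (Finset.mem_univ j)
          simpa using this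
        simp [hz, h0] at hξ
      have hc : ‖(((√s)⁻¹ : ℝ) : ℂ)‖ ^ 2 = s⁻¹ := by
        rw [Complex.norm_real, Real.norm_of_nonneg (by positivity), inv_pow, Real.sq_sqrt hs0]
      refine ⟨fun j => (((√s)⁻¹ : ℝ) : ℂ) • ξ j, ?_, fun _ => ?_⟩
      · simp only [norm_smul, mul_pow, ← Finset.mul_sum, hc]
        rw [← hs, inv_mul_cancel₀ hspos.ne']
      · simp only [map_smul, ← Finset.smul_sum, norm_smul, mul_pow, ← Finset.mul_sum, hc]
        rw [le_inv_mul_iff₀ hspos, mul_comm]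
        exact hξ.le
    · exact ⟨0, by simp, fun h => absurd h hn⟩
  choose ξ hξ1 hξ2 using hex
  -- The almost norming vectors at the single indices are bounded, so together they form vectors of
  -- the ultraproduct, at which the limit matrix still has size at least `M'`.
  let Ξ : Fin k → BoundedSeq H := fun j => BoundedSeq.mk (fun n => ξ n j) ⟨1, fun n => by
    have := (Finset.single_le_sum (f := fun j => ‖ξ n j‖ ^ 2) (fun _ _ => by positivity)
      (Finset.mem_univ j)).trans (hξ1 n)
    simpa using (sq_le_one_iff₀ (norm_nonneg _)).1 this⟩
  have key := sum_norm_sq_le_norm_matrixOperator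
    (Matrix.of fun i j => ultraOp (T i j) (hT i j)) (fun j => (Ξ j : UltraHilbert H))
  simp only [Matrix.of_apply, ultraOp_coe, ← coe_sum_ultra,
      UniformSpace.Completion.norm_coe] at key
  have e1 : ∑ j, ‖Ξ j‖ ^ 2 ≤ 1 :=
    le_of_tendsto' (tendsto_finsetSum _ fun i _ => BoundedSeq.tendsto_norm_sq _) fun n => hξ1 n
  have e2 : M' ^ 2 ≤ ∑ i, ‖∑ j, BoundedSeq.map (T i j) (hT i j) (Ξ j)‖ ^ 2 := by
    refine ge_of_tendsto (tendsto_finsetSum _ fun i _ => BoundedSeq.tendsto_norm_sq _) ?_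
    filter_upwards [(Nat.hyperfilter_le_atTop : (hyperfilter ℕ : Filter ℕ) ≤ atTop) h] with n hn
    simp only [BoundedSeq.term_sum, BoundedSeq.term_map]
    exact hξ2 n hn
  have e3 : M' ^ 2 ≤ ‖matrixOperator (Matrix.of fun i j => ultraOp (T i j) (hT i j))‖ ^ 2 := by
    refine e2.trans (key.trans ?_)
    nlinarith [sq_nonneg ‖matrixOperator (Matrix.of fun i j => ultraOp (T i j) (hT i j))‖]
  exact absurd (le_of_sq_le_sq e3 (norm_matrixOperator_nonneg _)) (not_le.2 h1)

end Ultraproduct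

/-! ### Inductive limits -/

section Chain

/-- The inclusion of an operator space in `B(H)`. -/
def OpSpace.incl (X : OpSpace.{u}) : X →ₗ[ℂ] (X.H →L[ℂ] X.H) := X.space.subtype

variable {L : ℕ → OpSpace.{u}} (w : ∀ n, L n →ₗ[ℂ] L (n + 1))

/-- The composite maps in a sequence of linear maps. -/
def transition (m : ℕ) : ∀ n, m ≤ n → (L m →ₗ[ℂ] L n) := fun _ h =>
  Nat.leRec (motive := fun n _ => L m →ₗ[ℂ] L n) LinearMap.id (fun n _ f => w n ∘ₗ f) h

theorem transition_self (m : ℕ) : transition w m m le_rfl = LinearMap.id :=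
  Nat.leRec_self _ _

theorem transition_succ {m n : ℕ} (h : m ≤ n) :
    transition w m (n + 1) (Nat.le_succ_of_le h) = w n ∘ₗ transition w m n h :=
  Nat.leRec_succ _ _ h

theorem transition_comp {m n : ℕ} (h : m + 1 ≤ n) :
    transition w (m + 1) n h ∘ₗ w m = transition w m n (Nat.le_of_succ_le h) := by
  induction n, h using Nat.le_induction with
  | base =>
    rw [transition_self, transition_succ w le_rfl, transition_self]
    rfl
  | succ n h ih =>
    rw [transition_succ w h, LinearMap.comp_assoc, ih, ← transition_succ]

variable {w} {c : ℕ → ℝ} (hc : ∀ n, 1 ≤ c n) (h1 : ∀ n, CBLe (w n) (c n / c (n + 1)))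
  (h2 : ∀ n, CBGe (w n) (c n / c (n + 1)))
include hc

include h1 in
-- Constants written as ratios `c n / c (n + 1)` telescope under composition. As `c n ≥ 1`, all maps
-- out of `L m` are bounded by `c m`.
theorem cbLe_transition {m n : ℕ} (h : m ≤ n) : CBLe (transition w m n h) (c m / c n) := by
  have hp : ∀ n, 0 < c n := fun n => one_pos.trans_le (hc n)
  induction n, h using Nat.le_induction with
  | base => rw [transition_self, div_self (hp m).ne']; exact CBLe.id
  | succ n h ih =>
    rw [transition_succ w h]
    convert (h1 n).comp ih (div_pos (hp _) (hp _)).le using 1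
    field_simp [(hp n).ne', (hp (n + 1)).ne']

include h2 in
theorem cbGe_transition {m n : ℕ} (h : m ≤ n) : CBGe (transition w m n h) (c m / c n) := by
  have hp : ∀ n, 0 < c n := fun n => one_pos.trans_le (hc n)
  induction n, h using Nat.le_induction with
  | base => rw [transition_self, div_self (hp m).ne']; exact CBGe.id
  | succ n h ih =>
    rw [transition_succ w h]
    convert (h2 n).comp ih (div_pos (hp _) (hp _)).le using 1
    field_simp [(hp n).ne', (hp (n + 1)).ne']

variable (w) in
/-- The sequence of images of `x`, as operators. -/
def orbit (m : ℕ) (x : L m) (n : ℕ) : (L n).H →L[ℂ] (L n).H :=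
  -- Finitely many terms do not affect the ultraproduct, so the value for `n < m` is immaterial.
  if h : m ≤ n then (L n).incl (transition w m n h x) else 0

include h1 in
theorem exists_bound_orbit (m : ℕ) (x : L m) : ∃ C, ∀ n, ‖orbit w m x n‖ ≤ C := by
  refine ⟨c m * ‖x‖, fun n => ?_⟩
  have hm := hc m
  unfold orbit
  split_ifs with h
  · refine ((cbLe_transition hc h1 h).norm_le x).trans ?_
    gcongr
    exact div_le_self (by linarith) (hc n)
  · rw [norm_zero]; positivity

/-- The canonical maps into the operators on the ultraproduct. -/
def limitMap (m : ℕ) : L m →ₗ[ℂ]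
    (UltraHilbert (fun n => (L n).H) →L[ℂ] UltraHilbert (fun n => (L n).H)) where
  toFun x := ultraOp (orbit w m x) (exists_bound_orbit hc h1 m x)
  map_add' x y := ultraOp_ext fun ξ => by
    rw [_root_.add_apply, ultraOp_coe, ultraOp_coe, ultraOp_coe,
      ← UniformSpace.Completion.coe_add]
    congr 1
    ext n
    simp only [BoundedSeq.term_map, BoundedSeq.term_add, orbit]
    split_ifs <;> simp
  map_smul' a x := ultraOp_ext fun ξ => by
    rw [_root_.smul_apply, ultraOp_coe, ultraOp_coe, RingHom.id_apply,
      ← UniformSpace.Completion.coe_smul]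
    congr 1
    ext n
    simp only [BoundedSeq.term_map, BoundedSeq.term_smul, orbit]
    split_ifs <;> simp

theorem limitMap_comp (m : ℕ) (x : L m) :
    limitMap hc h1 (m + 1) (w m x) = limitMap hc h1 m x := by
  refine ultraOp_congr _ _ ?_
  filter_upwards [eventually_ge_atTop (m + 1)] with n hn
  rw [orbit, orbit, dif_pos hn, dif_pos (Nat.le_of_succ_le hn), ← transition_comp w hn]
  rfl

theorem norm_matrixOperator_orbit {k : ℕ} {m n : ℕ} (h : m ≤ n) (x : Matrix (Fin k) (Fin k) (L m)) :
    ‖matrixOperator (Matrix.of fun i j => orbit w m (x i j) n)‖ =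
      mnorm (x.map (transition w m n h)) := by
  have : (Matrix.of fun i j => orbit w m (x i j) n) =
      (x.map (transition w m n h)).map (L n).incl := by
    ext1 i j
    simp [orbit, h]
  rw [this]
  rfl

theorem cbLe_limitMap (m : ℕ) : CBLe (limitMap hc h1 m) (c m) := fun k x => by
  have hm := hc m
  refine norm_matrix_ultraOp_le (fun i j => orbit w m (x i j)) _
    (mul_nonneg (by linarith) (mnorm_nonneg x)) ?_
  filter_upwards [eventually_ge_atTop m] with n hn
  rw [norm_matrixOperator_orbit hc hn]
  refine (cbLe_transition hc h1 hn k x).trans ?_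
  have := mnorm_nonneg x
  gcongr
  exact div_le_self (by linarith) (hc n)

include h2 in
theorem cbGe_limitMap (m : ℕ) : CBGe (limitMap hc h1 m) (c m) := fun k x => by
  have hm := hc m
  have hm' : 0 < c m := by linarith
  rw [← div_le_iff₀' hm']
  refine le_norm_matrix_ultraOp (fun i j => orbit w m (x i j)) _ ?_
  filter_upwards [eventually_ge_atTop m] with n hn
  rw [norm_matrixOperator_orbit hc hn, div_le_iff₀' hm']
  refine (cbGe_transition hc h2 hn k x).trans ?_
  have := mnorm_nonneg (x.map (transition w m n hn))
  gcongr
  exact div_le_self (by linarith) (hc n)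

include h1 h2 in
/-- The inductive limit of a sequence of operator spaces and almost completely isometric maps. -/
theorem exists_chain_limit : ∃ (X : OpSpace.{u}) (j : ∀ n, L n →ₗ[ℂ] X),
    (∀ n x, j (n + 1) (w n x) = j n x) ∧ (∀ n, CBLe (j n) (c n)) ∧ (∀ n, CBGe (j n) (c n)) ∧
      closure (⋃ n, (LinearMap.range (j n) : Set X)) = Set.univ := by
  let J := limitMap hc h1
  let R := ⨆ m, LinearMap.range (J m)
  let X : OpSpace.{u} :=
    { H := UltraHilbert (fun n => (L n).H)
      space := R.topologicalClosure
      isClosed_space := R.isClosed_topologicalClosure }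
  have hmem : ∀ m x, J m x ∈ R.topologicalClosure := fun m x =>
    R.le_topologicalClosure (le_iSup (fun m => LinearMap.range (J m)) m ⟨x, rfl⟩)
  let j : ∀ n, L n →ₗ[ℂ] X := fun m => (J m).codRestrict R.topologicalClosure (hmem m)
  have hmono : Monotone fun m => LinearMap.range (J m) := monotone_nat_of_le_succ fun n => by
    rintro _ ⟨x, rfl⟩
    exact ⟨w n x, limitMap_comp hc h1 n x⟩
  refine ⟨X, j, fun n x => Subtype.ext (limitMap_comp hc h1 n x), cbLe_limitMap hc h1,
    cbGe_limitMap hc h1 h2, ?_⟩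
  refine Set.eq_univ_of_forall fun x => Metric.mem_closure_iff.2 fun ε hε => ?_
  obtain ⟨y, hy, hxy⟩ := Metric.mem_closure_iff.1
    (show X.incl x ∈ closure (R : Set _) from x.2) ε hε
  obtain ⟨m, z, rfl⟩ := (Submodule.mem_iSup_of_directed _ hmono.directed_le).1 hy
  exact ⟨j m z, Set.mem_iUnion.2 ⟨m, z, rfl⟩, hxy⟩

end Chain

/-! ### Approximation by maps into dense subspaces, separability of classes -/

section Density

theorem exists_perturbation_constant {a b q : ℝ} (hq : 1 < q) (ha : 0 < a) (hb : 0 < b) :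
    ∃ η : ℝ, 0 < η ∧ η ≤ (q - 1) * a ∧ η * b ≤ 1 - q⁻¹ := by
  have h1 : 0 < 1 - q⁻¹ := sub_pos.2 (inv_lt_one_of_one_lt₀ hq)
  refine ⟨min ((q - 1) * a) ((1 - q⁻¹) / b), lt_min (mul_pos (by linarith) ha) (div_pos h1 hb),
    min_le_left _ _, ?_⟩
  calc _ ≤ (1 - q⁻¹) / b * b := by gcongr; exact min_le_right _ _
    _ = _ := div_mul_cancel₀ _ hb.ne'

/-- A linear map on a finite-dimensional space can be approximated by maps with prescribed kinds
of values on a basis. -/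
theorem exists_basis_approx {V W : Type u} [NormedAddCommGroup V] [NormedSpace ℂ V] [MatrixNorms V]
    [ConcreteNorms V] [NormedAddCommGroup W] [NormedSpace ℂ W] [MatrixNorms W] [ConcreteNorms W]
    [FiniteDimensional ℂ V] {ι : Type*} [Fintype ι] (e : Module.Basis ι ℂ V) (u : V →ₗ[ℂ] W) {η : ℝ}
    (hη : 0 < η) : ∃ r : ℝ, 0 < r ∧ ∀ v : V →ₗ[ℂ] W, (∀ i, ‖v (e i) - u (e i)‖ ≤ r) →
      CBLe (v - u) η := by
  set K := ∑ i, ‖(e.coord i).toContinuousLinearMap‖ with hK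
  have hK0 : 0 ≤ K := by positivity
  refine ⟨η / (1 + K), by positivity, fun v hv => (cbLe_sum_basis e (v - u)).mono ?_⟩
  calc ∑ i, ‖(e.coord i).toContinuousLinearMap‖ * ‖(v - u) (e i)‖
      ≤ ∑ i, ‖(e.coord i).toContinuousLinearMap‖ * (η / (1 + K)) := by
        gcongr with i; exact hv i
    _ = K * (η / (1 + K)) := by rw [← Finset.sum_mul]
    _ ≤ (1 + K) * (η / (1 + K)) := by gcongr; linarith
    _ = η := mul_div_cancel₀ _ (by positivity)

/-- A basis has finitely many values to approximate, and these lie in the range of one `j n`. All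
large `n` are allowed, so that further demands on `n` can be met simultaneously. -/
theorem exists_approx_of_dense {X : OpSpace.{u}} {L : ℕ → OpSpace.{u}} {j : ∀ n, L n →ₗ[ℂ] X}
    (hmono : Monotone fun n => LinearMap.range (j n))
    (hdense : closure (⋃ n, (LinearMap.range (j n) : Set X)) = Set.univ) {V : Type u}
    [NormedAddCommGroup V] [NormedSpace ℂ V] [MatrixNorms V] [ConcreteNorms V]
    [FiniteDimensional ℂ V] (u : V →ₗ[ℂ] X) {η : ℝ} (hη : 0 < η) :
    ∃ N, ∀ n ≥ N, ∃ v : V →ₗ[ℂ] L n, CBLe (j n ∘ₗ v - u) η := by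
  let e := Module.finBasis ℂ V
  obtain ⟨r, hr, H⟩ := exists_basis_approx e u hη
  have h1 : ∀ i, ∃ N, ∃ y : L N, ‖j N y - u (e i)‖ ≤ r := fun i => by
    obtain ⟨y, hy, hd⟩ := Metric.mem_closure_iff.1 (hdense ▸ Set.mem_univ (u (e i))) r hr
    obtain ⟨N, z, rfl⟩ := Set.mem_iUnion.1 hy
    exact ⟨N, z, by rw [← dist_eq_norm, dist_comm]; exact hd.le⟩
  choose N y hy using h1
  refine ⟨Finset.univ.sup N, fun n hn => ?_⟩
  have h2 : ∀ i, ∃ z : L n, j n z = j (N i) (y i) := fun i =>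
    hmono ((Finset.le_sup (Finset.mem_univ i)).trans hn) ⟨y i, rfl⟩
  choose z hz using h2
  refine ⟨e.constr ℂ z, H _ fun i => ?_⟩
  rw [LinearMap.comp_apply, Module.Basis.constr_basis, hz]
  exact hy i

theorem exists_equiv_of_dcb_lt {V W : Type u} [NormedAddCommGroup V] [NormedSpace ℂ V]
    [MatrixNorms V] [ConcreteNorms V] [NormedAddCommGroup W] [NormedSpace ℂ W] [MatrixNorms W]
    [ConcreteNorms W] [FiniteDimensional ℂ V] {q : ℝ} (hq : 0 ≤ q)
    (h : dcb V W < ENNReal.ofReal q) : ∃ e : V ≃ₗ[ℂ] W, Distort (e : V →ₗ[ℂ] W) q := by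
  obtain ⟨e, he⟩ := iInf_lt_iff.1 h
  exact ⟨e, Distort.of_distortion_le e.injective hq he.le⟩

/-- A subspace can be moved onto the span of elements of a dense sequence by an automorphism close
to the identity. -/
theorem exists_automorphism {E : OpSpace.{u}} [FiniteDimensional ℂ E] {d : ℕ → E}
    (hd : DenseRange d) (S : Submodule ℂ E) {q : ℝ} (hq : 1 < q) :
    ∃ (s : Finset ℕ) (g : E ≃ₗ[ℂ] E), S.map (g : E →ₗ[ℂ] E) = Submodule.span ℂ (d '' s) ∧
      Distort (g : E →ₗ[ℂ] E) (q * q) := by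
  classical
  let b := Module.finBasis ℂ S
  obtain ⟨P, hP⟩ := S.subtype.exists_leftInverse_of_injective (Submodule.ker_subtype S)
  obtain ⟨p, hp0, hp⟩ := exists_cbLe P
  obtain ⟨η, hη0, hη1, hη2⟩ := exists_perturbation_constant hq one_pos one_pos
  obtain ⟨r, hr, H⟩ := exists_basis_approx b S.subtype (div_pos hη0 hp0)
  have h1 : ∀ i, ∃ k, ‖d k - b i‖ ≤ r := fun i => by
    obtain ⟨k, hk⟩ := hd.exists_dist_lt (b i : E) hr
    exact ⟨k, by rw [← dist_eq_norm, dist_comm]; exact hk.le⟩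
  choose k hk using h1
  let h : S →ₗ[ℂ] E := b.constr ℂ fun i => d (k i)
  have hb : ∀ i, h (b i) = d (k i) := fun i => by simp [h]
  have hh : CBLe (h - S.subtype) (η / p) := H h fun i => by
    rw [hb]; exact hk i
  -- This map is `h` on `S` and the identity on the kernel of the projection `P`. It therefore takes
  -- `S` exactly onto the span of the chosen points.
  let g₀ : E →ₗ[ℂ] E := LinearMap.id + (h - S.subtype) ∘ₗ P
  have hg₀ : CBLe (g₀ - LinearMap.id) η := by
    have := hh.comp hp (div_pos hη0 hp0).le
    rw [div_mul_cancel₀ _ hp0.ne'] at this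
    simpa [g₀] using this
  have hgS : ∀ s : S, g₀ s = h s := fun s => by
    have : P s = s := LinearMap.congr_fun hP s
    simp [g₀, this]
  obtain ⟨k1, k2⟩ := bounds_of_close hq one_pos CBLe.id CBGe.id hη1 hη2 hg₀
  rw [mul_one] at k1 k2
  refine ⟨Finset.univ.image k, LinearEquiv.ofInjectiveEndo g₀ k2.injective, ?_,
    distort_of_bounds (by linarith) (by linarith) k1 k2⟩
  have e1 : S.map g₀ = LinearMap.range h := by
    ext x
    simp only [Submodule.mem_map, LinearMap.mem_range]
    exact ⟨fun ⟨y, hy, e⟩ => ⟨⟨y, hy⟩, by rw [← hgS]; exact e⟩,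
      fun ⟨y, e⟩ => ⟨y, y.2, by rw [hgS]; exact e⟩⟩
  have e2 : ((LinearEquiv.ofInjectiveEndo g₀ k2.injective : E ≃ₗ[ℂ] E) : E →ₗ[ℂ] E) = g₀ := by
    ext x; rfl
  rw [e2, e1, ← Submodule.map_top, ← b.span_eq, Submodule.map_span, ← Set.range_comp]
  congr 1
  ext x
  simp [hb]

/-- Separability concerns the spaces only. Their subspaces are made countable by keeping only spans
of finitely many points of a dense sequence. One factor `q` pays for the isomorphism onto a member
of the countable family, and `q * q` for the automorphism that moves the image of `S` onto such a
span. -/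
theorem exists_patterns {𝓔 : Set OpSpace.{u}} (hfd : ∀ E ∈ 𝓔, FiniteDimensional ℂ E)
    (hne : ∃ E ∈ 𝓔, Nontrivial E) (hsep : IsSeparableClass 𝓔) :
    ∃ p : ℕ → (E : OpSpace.{u}) × Submodule ℂ E, (∀ i, (p i).1 ∈ 𝓔) ∧
      ∀ L ∈ 𝓔, ∀ S : Submodule ℂ L, ∀ q : ℝ, 1 < q → ∃ (i : ℕ) (e : L ≃ₗ[ℂ] (p i).1),
        S.map (e : L →ₗ[ℂ] (p i).1) = (p i).2 ∧ Distort (e : L →ₗ[ℂ] (p i).1) (q * q * q) := by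
  obtain ⟨𝓓, h𝓓, hcount, hdense⟩ := hsep
  have hd : ∀ E : OpSpace.{u}, ∃ d : ℕ → E, FiniteDimensional ℂ E → DenseRange d := fun E => by
    by_cases h : FiniteDimensional ℂ E
    · have : ProperSpace E := FiniteDimensional.proper ℂ E
      exact ⟨denseSeq E, fun _ => denseRange_denseSeq E⟩
    · exact ⟨0, fun h' => absurd h' h⟩
  choose d hd using hd
  let Pat : Set ((E : OpSpace.{u}) × Submodule ℂ E) :=
    ⋃ E ∈ 𝓓, Set.range fun s : Finset ℕ => ⟨E, Submodule.span ℂ (d E '' s)⟩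
  have hc : Pat.Countable := hcount.biUnion fun E _ => Set.countable_range _
  have hmem : ∀ L ∈ 𝓔, ∀ S : Submodule ℂ L, ∀ q : ℝ, 1 < q → ∃ p ∈ Pat, ∃ (e : L ≃ₗ[ℂ] p.1),
        S.map (e : L →ₗ[ℂ] p.1) = p.2 ∧ Distort (e : L →ₗ[ℂ] p.1) (q * q * q) := by
    intro L hL S q hq
    have := hfd L hL
    obtain ⟨E, hE, hlt⟩ := hdense L hL (q - 1) (by linarith)
    have := hfd E (h𝓓 hE)
    rw [add_sub_cancel] at hlt
    obtain ⟨e, he⟩ := exists_equiv_of_dcb_lt (by linarith) hlt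
    obtain ⟨s, g, hg1, hg2⟩ := exists_automorphism (hd E this) (S.map (e : L →ₗ[ℂ] E)) hq
    refine ⟨⟨E, Submodule.span ℂ (d E '' s)⟩, Set.mem_biUnion hE ⟨s, rfl⟩, e.trans g, ?_, ?_⟩
    · rw [LinearEquiv.coe_trans, Submodule.map_comp]
      exact hg1
    · rw [LinearEquiv.coe_trans]
      exact hg2.comp he
  obtain ⟨E, hE, -⟩ := hne
  obtain ⟨p, hp, -⟩ := hmem E hE ⊥ 2 (by norm_num)
  obtain ⟨f, hf⟩ := hc.exists_eq_range ⟨p, hp⟩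
  refine ⟨f, fun i => ?_, fun L hL S q hq => ?_⟩
  · have : f i ∈ Pat := hf ▸ ⟨i, rfl⟩
    simp only [Pat, Set.mem_iUnion] at this
    obtain ⟨E, hE, s, hs⟩ := this
    rw [← hs]
    exact h𝓓 hE
  · obtain ⟨p, hp, h⟩ := hmem L hL S q hq
    rw [hf] at hp
    obtain ⟨i, rfl⟩ := hp
    exact ⟨i, h⟩

end Density

/-! ### Amalgamation with real constants -/

section Amalgamation

/-- The extension property behind the Gurarii classes, with an embedding `φ` of given quality. -/
def AmalgamatesAt (𝓔 : Set OpSpace.{u}) (σ : ℝ) : Prop :=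
  ∀ L ∈ 𝓔, ∀ E ∈ 𝓔, ∀ (S : Submodule ℂ L) (u : S →ₗ[ℂ] E), Function.Injective u →
    ∀ κ : ℝ, 1 < κ → ∃ E₁ ∈ 𝓔, ∃ φ : E →ₗ[ℂ] E₁, CBLe φ σ ∧ CBGe φ σ ∧
      ∃ v : L →ₗ[ℂ] E₁, (∀ s : S, v s = φ (u s)) ∧
        ∀ C : ℝ, 1 ≤ C → Distort u C → Distort v (κ * C)

theorem distort_of_distortion_le_mul {V V' W W' : Type u} [NormedAddCommGroup V] [NormedSpace ℂ V]
    [MatrixNorms V] [ConcreteNorms V] [NormedAddCommGroup W] [NormedSpace ℂ W] [MatrixNorms W]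
    [ConcreteNorms W] [NormedAddCommGroup V'] [NormedSpace ℂ V']
    [MatrixNorms V'] [ConcreteNorms V'] [NormedAddCommGroup W'] [NormedSpace ℂ W'] [MatrixNorms W']
    [ConcreteNorms W'] [FiniteDimensional ℂ V'] {u : V →ₗ[ℂ] W} {v : V' →ₗ[ℂ] W'}
    {hu : Function.Injective u} {hv : Function.Injective v} {κ C : ℝ} (hκ : 1 < κ)
    (h : distortion v hv ≤ ENNReal.ofReal κ * distortion u hu) (hC : 1 ≤ C) (huC : Distort u C) :
    Distort v (κ * C) := by
  refine Distort.of_distortion_le hv (by positivity) (h.trans ?_)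
  rw [ENNReal.ofReal_mul (by linarith)]
  gcongr
  exact huC.distortion_le hC hu

theorem IsLooselyGurariiClass.amalgamatesAt {𝓔 : Set OpSpace.{u}}
    (hfd : ∀ E ∈ 𝓔, FiniteDimensional ℂ E) (h : IsLooselyGurariiClass 𝓔) {σ : ℝ} (hσ : 1 < σ) :
    AmalgamatesAt 𝓔 σ := by
  intro L hL E hE S u hu κ hκ
  obtain ⟨E₁, hE₁, φ, hφ, v, hv, hvu, hD⟩ :=
    h (σ - 1) (by linarith) L hL E hE S u hu (κ - 1) (by linarith)
  rw [isEpsEmbedding_iff (by linarith), add_sub_cancel] at hφ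
  rw [add_sub_cancel] at hD
  have := hfd L hL
  exact ⟨E₁, hE₁, φ, hφ.1, hφ.2, v, hvu, fun C hC huC => distort_of_distortion_le_mul hκ hD hC huC⟩

theorem IsGurariiClass.amalgamatesAt {𝓔 : Set OpSpace.{u}}
    (hfd : ∀ E ∈ 𝓔, FiniteDimensional ℂ E) (h : IsGurariiClass 𝓔) : AmalgamatesAt 𝓔 1 := by
  intro L hL E hE S u hu κ hκ
  obtain ⟨E₁, hE₁, φ, hφ, v, hv, hvu, hD⟩ := h L hL E hE S u hu (κ - 1) (by linarith)
  rw [isCompleteIsometry_iff] at hφ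
  rw [add_sub_cancel] at hD
  have := hfd L hL
  exact ⟨E₁, hE₁, φ, hφ.1, hφ.2, v, hvu, fun C hC huC => distort_of_distortion_le_mul hκ hD hC huC⟩

end Amalgamation

/-! ### Solving finitely many extension problems -/

section Tasks

variable {𝓔 : Set OpSpace.{u}} {p : ℕ → (E : OpSpace.{u}) × Submodule ℂ E}

/-- A set of admissible bounds for the embeddings in amalgamations: all numbers `> 1` for a
loosely Gurarii class, and `{1}` for a Gurarii class. -/
structure IsAmalgamationScale (𝓔 : Set OpSpace.{u}) (Q : Set ℝ) : Prop where
  one_le : ∀ σ ∈ Q, 1 ≤ σ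
  amalgamates : ∀ σ ∈ Q, AmalgamatesAt 𝓔 σ
  exists_small : ∀ σ ∈ Q, ∀ κ : ℝ, 1 < κ → ∃ τ ∈ Q, τ * τ ≤ σ ∧ τ * τ ≤ κ

theorem IsLooselyGurariiClass.isAmalgamationScale (hfd : ∀ E ∈ 𝓔, FiniteDimensional ℂ E)
    (h : IsLooselyGurariiClass 𝓔) : IsAmalgamationScale 𝓔 (Set.Ioi 1) where
  one_le σ hσ := hσ.le
  amalgamates σ hσ := h.amalgamatesAt hfd hσ
  exists_small σ hσ κ hκ := by
    have hm : 1 < min σ κ := lt_min hσ hκ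
    refine ⟨√(min σ κ), ?_, ?_, ?_⟩
    · simpa [Real.lt_sqrt] using And.intro hσ hκ
    · rw [Real.mul_self_sqrt (by linarith)]; exact min_le_left _ _
    · rw [Real.mul_self_sqrt (by linarith)]; exact min_le_right _ _

theorem IsGurariiClass.isAmalgamationScale (hfd : ∀ E ∈ 𝓔, FiniteDimensional ℂ E)
    (h : IsGurariiClass 𝓔) : IsAmalgamationScale 𝓔 {1} where
  one_le σ hσ := (Set.mem_singleton_iff.1 hσ).ge
  amalgamates σ hσ := by
    rw [Set.mem_singleton_iff.1 hσ]; exact h.amalgamatesAt hfd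
  exists_small σ hσ κ hκ :=
    ⟨1, rfl, by rw [Set.mem_singleton_iff.1 hσ, one_mul], by linarith⟩

/-- The problems are amalgamated one at a time. Solutions already found are pushed forward by the
next embedding, and the new problem is first transported by the embeddings made so far; either way
the loss is `τ * τ ≤ √κ`. Splitting `σ` and `κ` anew at each step lets any finite number of problems
fit. -/
theorem exists_extend_finite {Q : Set ℝ} (hQ : IsAmalgamationScale 𝓔 Q) (hp : ∀ i, (p i).1 ∈ 𝓔)
    {M : OpSpace.{u}} (hM : M ∈ 𝓔) {T : Set (Σ i, (p i).2 →ₗ[ℂ] M)} (hT : T.Finite) :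
    (∀ t ∈ T, Function.Injective t.2) → ∀ σ ∈ Q, ∀ κ : ℝ, 1 < κ →
      ∃ M' ∈ 𝓔, ∃ φ : M →ₗ[ℂ] M', CBLe φ σ ∧ CBGe φ σ ∧ ∀ t ∈ T, ∃ v : (p t.1).1 →ₗ[ℂ] M',
        (∀ s : (p t.1).2, v s = φ (t.2 s)) ∧
          ∀ C : ℝ, 1 ≤ C → Distort t.2 C → Distort v (κ * C) := by
  induction T, hT using Set.Finite.induction_on with
  | empty =>
    intro _ σ hσ κ hκ
    exact ⟨M, hM, LinearMap.id, CBLe.id.mono (hQ.one_le σ hσ), CBGe.id.mono (hQ.one_le σ hσ),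
      by simp⟩
  | @insert t T _ _ ih =>
    intro hinj σ hσ κ hκ
    have hκ0 : 1 < √κ := by rw [Real.lt_sqrt (by norm_num)]; simpa using hκ
    have hκκ : √κ * √κ = κ := Real.mul_self_sqrt (by linarith)
    obtain ⟨τ, hτ, hτσ, hτκ⟩ := hQ.exists_small σ hσ _ hκ0
    have hτ1 := hQ.one_le τ hτ
    have hτ0 : 0 < τ := by linarith
    obtain ⟨M₁, hM₁, φ₁, k1, k2, h₁⟩ :=
      ih (fun t ht => hinj t (Set.mem_insert_of_mem _ ht)) τ hτ _ hκ0
    have hti := hinj t (Set.mem_insert _ _)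
    obtain ⟨M₂, hM₂, φ₂, l1, l2, v, hv, hD⟩ := hQ.amalgamates τ hτ (p t.1).1 (hp _) M₁ hM₁ (p t.1).2
      (φ₁ ∘ₗ t.2) (k2.injective.comp hti) _ hκ0
    refine ⟨M₂, hM₂, φ₂ ∘ₗ φ₁, (l1.comp k1 hτ0.le).mono hτσ, (l2.comp k2 hτ0.le).mono hτσ, ?_⟩
    intro t' ht'
    rcases Set.mem_insert_iff.1 ht' with rfl | ht'
    · refine ⟨v, hv, fun C hC h => ?_⟩
      have h1 : Distort (φ₁ ∘ₗ t'.2) (τ * τ * C) := (distort_of_bounds hτ0 hτ0 k1 k2).comp h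
      refine (hD _ (by nlinarith) h1).mono ?_
      calc √κ * (τ * τ * C) ≤ √κ * (√κ * C) := by gcongr
        _ = κ * C := by rw [← mul_assoc, hκκ]
    · obtain ⟨v', hv', hD'⟩ := h₁ t' ht'
      refine ⟨φ₂ ∘ₗ v', fun s => by simp [hv'], fun C hC h => ?_⟩
      refine ((distort_of_bounds hτ0 hτ0 l1 l2).comp (hD' C hC h)).mono ?_
      calc τ * τ * (√κ * C) ≤ √κ * (√κ * C) := by gcongr
        _ = κ * C := by rw [← mul_assoc, hκκ]

/-- Up to a perturbation, all extension problems for the first `n` patterns and for maps of norm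
at most `n` into `L` can be solved in `L'`, with constant `κ`. -/
def ExtendsPatterns (p : ℕ → (E : OpSpace.{u}) × Submodule ℂ E) (n : ℕ) (κ : ℝ) {L L' : OpSpace.{u}}
    (w : L →ₗ[ℂ] L') : Prop :=
  ∀ i ≤ n, ∀ u : (p i).2 →ₗ[ℂ] L, Function.Injective u → (∀ x, ‖u x‖ ≤ n * ‖x‖) →
    ∃ u' : (p i).2 →ₗ[ℂ] L, (∀ x, ‖(u' - u) x‖ ≤ 1 / ((n : ℝ) + 1) * ‖x‖) ∧
      ∃ v : (p i).1 →ₗ[ℂ] L', (∀ s : (p i).2, v s = w (u' s)) ∧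
        ∀ C : ℝ, 1 ≤ C → Distort u' C → Distort v (κ * C)

theorem ExtendsPatterns.comp {n : ℕ} {κ C₁ : ℝ} {L L' L'' : OpSpace.{u}} {φ : L →ₗ[ℂ] L'}
    (h : ExtendsPatterns p n κ φ) {w : L' →ₗ[ℂ] L''} (hw : Distort w C₁) :
    ExtendsPatterns p n (C₁ * κ) (w ∘ₗ φ) := by
  intro i hi u hu hun
  obtain ⟨u', hu', v, hv, hD⟩ := h i hi u hu hun
  exact ⟨u', hu', w ∘ₗ v, fun s => by simp [hv], fun C hC hC' =>
    (hw.comp (hD C hC hC')).mono (by rw [mul_assoc])⟩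

/-- Bounded sets of maps between finite-dimensional spaces are totally bounded. The net is taken
inside the set of injective maps, since only these can be amalgamated. -/
theorem exists_finite_net {V W : Type u} [NormedAddCommGroup V] [NormedSpace ℂ V]
    [FiniteDimensional ℂ V] [NormedAddCommGroup W] [NormedSpace ℂ W] [FiniteDimensional ℂ W]
    (n : ℕ) {ε : ℝ} (hε : 0 < ε) :
    ∃ t : Set (V →ₗ[ℂ] W), t.Finite ∧ (∀ u ∈ t, Function.Injective u) ∧
      ∀ u : V →ₗ[ℂ] W, Function.Injective u → (∀ x, ‖u x‖ ≤ n * ‖x‖) →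
        ∃ u' ∈ t, ∀ x, ‖(u' - u) x‖ ≤ ε * ‖x‖ := by
  have : ProperSpace (V →L[ℂ] W) := FiniteDimensional.proper ℂ (V →L[ℂ] W)
  have hsub : {u : V →L[ℂ] W | Function.Injective u ∧ ‖u‖ ≤ n} ⊆
      Metric.closedBall 0 (n : ℝ) := fun u hu => mem_closedBall_zero_iff.2 hu.2
  have htb := (isCompact_closedBall (0 : V →L[ℂ] W) (n : ℝ)).totallyBounded.subset hsub
  obtain ⟨t, ht, hfin, hcov⟩ := htb.exists_subset (Metric.dist_mem_uniformity hε)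
  refine ⟨(fun u : V →L[ℂ] W => (u : V →ₗ[ℂ] W)) '' t, hfin.image _, ?_, fun u hu hun => ?_⟩
  · rintro _ ⟨u, hu, rfl⟩
    exact (ht hu).1
  · have hmem : LinearMap.toContinuousLinearMap u ∈
        {u : V →L[ℂ] W | Function.Injective u ∧ ‖u‖ ≤ n} :=
      ⟨hu, ContinuousLinearMap.opNorm_le_bound _ (by positivity) hun⟩
    obtain ⟨u', hu', hd⟩ := Set.mem_iUnion₂.1 (hcov hmem)
    refine ⟨_, ⟨u', hu', rfl⟩, fun x => ?_⟩
    refine (u' - LinearMap.toContinuousLinearMap u).le_of_opNorm_le ?_ x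
    rw [← dist_eq_norm, dist_comm]
    exact le_of_lt hd

theorem exists_extendsPatterns (hfd : ∀ E ∈ 𝓔, FiniteDimensional ℂ E) {Q : Set ℝ}
    (hQ : IsAmalgamationScale 𝓔 Q) (hp : ∀ i, (p i).1 ∈ 𝓔)
    {M : OpSpace.{u}} (hM : M ∈ 𝓔) (n : ℕ) {σ κ : ℝ} (hσ : σ ∈ Q) (hκ : 1 < κ) :
    ∃ M' ∈ 𝓔, ∃ φ : M →ₗ[ℂ] M', CBLe φ σ ∧ CBGe φ σ ∧ ExtendsPatterns p n κ φ := by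
  have hMfd := hfd M hM
  have hpfd : ∀ i, FiniteDimensional ℂ (p i).1 := fun i => hfd _ (hp i)
  choose t hfin hinj hcov using fun i => exists_finite_net (V := (p i).2) (W := M) n
    (show (0 : ℝ) < 1 / ((n : ℝ) + 1) by positivity)
  let T : Set (Σ i, (p i).2 →ₗ[ℂ] M) := ⋃ i ∈ Set.Iic n,
    Sigma.mk i '' t i
  have hT : T.Finite := (Set.finite_Iic n).biUnion fun i _ => (hfin i).image _
  obtain ⟨M', hM', φ, h1, h2, h3⟩ := exists_extend_finite hQ hp hM hT (by
    intro s hs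
    simp only [T, Set.mem_iUnion] at hs
    obtain ⟨i, -, u, hu, rfl⟩ := hs
    exact hinj i u hu) σ hσ κ hκ
  refine ⟨M', hM', φ, h1, h2, fun i hi u hu hun => ?_⟩
  obtain ⟨u', hu', hd⟩ := hcov i u hu hun
  obtain ⟨v, hv, hD⟩ := h3 ⟨i, u'⟩ (Set.mem_biUnion (show i ∈ Set.Iic n from hi) ⟨u', hu', rfl⟩)
  exact ⟨u', hd, v, hv, hD⟩

end Tasks

/-! ### Limits of sequences that solve extension problems are Gurarii spaces -/

/-- Used to pay for all losses of a construction in powers of a single factor `q`. -/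
theorem exists_pow_le {T : ℝ} (hT : 1 < T) (k : ℕ) : ∃ q : ℝ, 1 < q ∧ q ^ k ≤ T := by
  have hl : 0 < Real.log T := Real.log_pos hT
  refine ⟨Real.exp (Real.log T / (k + 1)), Real.one_lt_exp_iff.2 (by positivity), ?_⟩
  rw [← Real.exp_nat_mul, ← Real.le_log_iff_exp_le (by linarith), mul_div_assoc',
    div_le_iff₀ (by positivity)]
  nlinarith

section

variable {V W Z : Type u} [NormedAddCommGroup V] [NormedSpace ℂ V] [MatrixNorms V]
  [NormedAddCommGroup W] [NormedSpace ℂ W] [MatrixNorms W]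
  [NormedAddCommGroup Z] [NormedSpace ℂ Z] [MatrixNorms Z]

theorem CBLe.of_comp {v : W →ₗ[ℂ] Z} {u : V →ₗ[ℂ] W} {a b : ℝ} (hv : CBGe v b)
    (h : CBLe (v ∘ₗ u) a) (hb : 0 ≤ b) : CBLe u (b * a) := fun n x => by
  calc mnorm (x.map u) ≤ b * mnorm ((x.map u).map v) := hv n _
    _ ≤ b * (a * mnorm x) := by gcongr; exact h n x
    _ = _ := by ring

theorem CBGe.of_comp {v : W →ₗ[ℂ] Z} {u : V →ₗ[ℂ] W} {a b : ℝ} (hv : CBLe v a)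
    (h : CBGe (v ∘ₗ u) b) (hb : 0 ≤ b) : CBGe u (b * a) := fun n x => by
  calc mnorm x ≤ b * mnorm ((x.map u).map v) := h n x
    _ ≤ b * (a * mnorm (x.map u)) := by gcongr; exact hv n _
    _ = _ := by ring

variable [ConcreteNorms V] [ConcreteNorms W] [ConcreteNorms Z]

theorem Distort.dcb_range_le {v : V →ₗ[ℂ] W} {C : ℝ} (h : Distort v C) (hC : 1 ≤ C) :
    dcb V (LinearMap.range v) ≤ ENNReal.ofReal C := by
  have : Distort (LinearEquiv.ofInjective v h.injective : V →ₗ[ℂ] LinearMap.range v) C := h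
  exact (iInf_le _ _).trans (this.distortion_le hC _)

end

section Limit

variable {𝓔 : Set OpSpace.{u}} {L : ℕ → OpSpace.{u}} {w : ∀ n, L n →ₗ[ℂ] L (n + 1)}
  {X : OpSpace.{u}} {j : ∀ n, L n →ₗ[ℂ] X}

theorem monotone_range_of_compat (hjw : ∀ n x, j (n + 1) (w n x) = j n x) :
    Monotone fun n => LinearMap.range (j n) :=
  monotone_nat_of_le_succ fun n => by
    rintro _ ⟨x, rfl⟩
    exact ⟨w n x, hjw n x⟩

theorem separableSpace_of_exhaustion (hfd : ∀ n, FiniteDimensional ℂ (L n))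
    (hdense : closure (⋃ n, (LinearMap.range (j n) : Set X)) = Set.univ) : SeparableSpace X := by
  rw [← isSeparable_univ_iff, ← hdense]
  refine (IsSeparable.iUnion fun n => ?_).closure
  have : ProperSpace (L n) := FiniteDimensional.proper ℂ (L n)
  rw [LinearMap.coe_range]
  exact isSeparable_range (j n).continuous_of_finiteDimensional

variable {c : ℕ → ℝ}

/-- The inclusion of `F` is close to some `j n ∘ v`, and `j n` is almost completely isometric for
large `n`, so `v` embeds `F` almost completely isometrically in `L n`. -/
theorem locallyEmbeds_limit (hL : ∀ n, L n ∈ 𝓔) (hc1 : ∀ n, 1 ≤ c n) (hc : Tendsto c atTop (𝓝 1))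
    (h1 : ∀ n, CBLe (j n) (c n)) (h2 : ∀ n, CBGe (j n) (c n))
    (hmono : Monotone fun n => LinearMap.range (j n))
    (hdense : closure (⋃ n, (LinearMap.range (j n) : Set X)) = Set.univ) :
    LocallyEmbeds X 𝓔 := by
  intro F hF ε hε
  obtain ⟨q, hq, hqε⟩ := exists_pow_le (show 1 < 1 + ε by linarith) 4
  obtain ⟨η, hη, hη1, hη2⟩ := exists_perturbation_constant hq one_pos one_pos
  obtain ⟨N, hN⟩ := exists_approx_of_dense hmono hdense F.subtype hη
  obtain ⟨n, hn, hcn⟩ := ((eventually_ge_atTop N).and (hc.eventually_le_const hq)).exists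
  obtain ⟨v, hv⟩ := hN n hn
  obtain ⟨k1, k2⟩ := bounds_of_close hq one_pos (CBLe.subtype F) (CBGe.subtype F) hη1 hη2 hv
  have hcp : 0 < c n := one_pos.trans_le (hc1 n)
  have l1 := CBLe.of_comp (h2 n) k1 hcp.le
  have l2 := CBGe.of_comp (h1 n) k2 (by linarith)
  have hD := distort_of_bounds (by positivity) (by positivity) l1 l2
  refine ⟨L n, hL n, LinearMap.range v,
    (hD.mono (C' := 1 + ε) ?_).dcb_range_le (by linarith)⟩
  calc c n * (q * 1) * (q * 1 * c n) ≤ q * (q * 1) * (q * 1 * q) := by gcongr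
    _ = q ^ 4 := by ring
    _ ≤ _ := hqε

/-- The problem is followed through the maps `u₁` (on a pattern), `u₂` (into `L n`) and `u₃` (in the
net). It is solved in `L (n + 1)`, pulled back to `V₂` on `L₀`, and corrected on `S` by `R`. -/
theorem hasGurariiProperty_limit {p : ℕ → (E : OpSpace.{u}) × Submodule ℂ E} {κ : ℕ → ℝ}
    (hfd : ∀ E ∈ 𝓔, FiniteDimensional ℂ E) (hp : ∀ i, (p i).1 ∈ 𝓔)
    (hpat : ∀ L ∈ 𝓔, ∀ S : Submodule ℂ L, ∀ q : ℝ, 1 < q → ∃ (i : ℕ) (e : L ≃ₗ[ℂ] (p i).1),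
        S.map (e : L →ₗ[ℂ] (p i).1) = (p i).2 ∧ Distort (e : L →ₗ[ℂ] (p i).1) (q * q * q))
    (hc1 : ∀ n, 1 ≤ c n) (hc : Tendsto c atTop (𝓝 1)) (hκ : Tendsto κ atTop (𝓝 1))
    (h1 : ∀ n, CBLe (j n) (c n)) (h2 : ∀ n, CBGe (j n) (c n))
    (hjw : ∀ n x, j (n + 1) (w n x) = j n x)
    (hdense : closure (⋃ n, (LinearMap.range (j n) : Set X)) = Set.univ)
    (hw : ∀ n, ExtendsPatterns p n (κ n) (w n)) : HasGurariiProperty X 𝓔 := by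
  intro ε hε L₀ hL₀ S u hu
  have := hfd L₀ hL₀
  obtain ⟨htop, hC1, hDu⟩ := distort_toReal hu
  set C := (distortion u hu).toReal with hC
  have hmono := monotone_range_of_compat hjw
  suffices H : ∃ v : L₀ →ₗ[ℂ] X, (∀ s : S, v s = u s) ∧ Distort v ((1 + ε) * C) by
    obtain ⟨v, hvu, hD⟩ := H
    refine ⟨v, hD.injective, hvu, (hD.distortion_le (by nlinarith) hD.injective).trans_eq ?_⟩
    rw [ENNReal.ofReal_mul (by linarith), hC, ENNReal.ofReal_toReal htop]
  obtain ⟨a, b, ha, hb, hab, hua, hub⟩ := hDu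
  -- The exponent is 3 (passing to the pattern), 4 (perturbation and `j n`), 1 (`κ n`), 3 (back
  -- along `e`), 2 (`j (n + 1)`) and 2 (final correction).
  obtain ⟨q, hq, hqε⟩ := exists_pow_le (show 1 < 1 + ε by linarith) 15
  have hq0 : 0 < q := by linarith
  obtain ⟨i, e, hSe, ae, be, hae, hbe, habe, hea, heb⟩ := hpat L₀ hL₀ S q hq
  have := hfd _ (hp i)
  -- the isomorphism between the subspaces
  let eS : S ≃ₗ[ℂ] (p i).2 := (e.submoduleMap S).trans (LinearEquiv.ofEq _ _ hSe)
  have heS : ∀ s : S, ((eS s : (p i).2) : (p i).1) = e s := fun s => rfl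
  have heSa : CBLe (eS : S →ₗ[ℂ] (p i).2) ae := fun n x => hea n (x.map (fun s : S => (s : L₀)))
  have heSb : CBGe (eS : S →ₗ[ℂ] (p i).2) be := fun n x => heb n (x.map (fun s : S => (s : L₀)))
  let u₁ : (p i).2 →ₗ[ℂ] X := u ∘ₗ (eS.symm : (p i).2 →ₗ[ℂ] S)
  have hu₁ : ∀ s, u₁ (eS s) = u s := fun s => by simp [u₁]
  have hu₁a : CBLe u₁ (a * be) := hua.comp heSb.of_equiv ha.le
  have hu₁b : CBGe u₁ (ae * b) := hub.comp heSa.of_equiv hae.le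
  set A := a * be with hA
  set B := ae * b with hB
  have hA0 : 0 < A := by positivity
  have hB0 : 0 < B := by positivity
  have hAB : A * B ≤ q ^ 3 * C := by
    calc A * B = (ae * be) * (a * b) := by rw [hA, hB]; ring
      _ ≤ (q * q * q) * C := by gcongr
      _ = _ := by ring
  obtain ⟨P, hP⟩ := S.subtype.exists_leftInverse_of_injective (Submodule.ker_subtype S)
  have hPs : ∀ s : S, P s = s := fun s => LinearMap.congr_fun hP s
  obtain ⟨pP, hpP, hPle⟩ := exists_cbLe P
  obtain ⟨η₁, hη₁, hη₁a, hη₁b⟩ := exists_perturbation_constant hq hA0 hB0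
  -- The map `V₂` to be corrected depends on `n`, which is chosen after `η`. The correction is
  -- therefore measured against a priori bounds for the constants of `V₂`: a lower bound for `a₂`
  -- and an upper bound for `b₂`, neither involving `n`.
  obtain ⟨η₂, hη₂, hη₂a, hη₂b⟩ := exists_perturbation_constant hq
    (show 0 < (q * B * be)⁻¹ by positivity) (show 0 < q ^ 13 * C * (q * B * be) by positivity)
  set η := min η₁ (η₂ / (ae * pP)) with hη
  have hη0 : 0 < η := lt_min hη₁ (by positivity)
  have hηa : η ≤ (q - 1) * A := (min_le_left _ _).trans hη₁a
  have hηb : η * B ≤ 1 - q⁻¹ := (mul_le_mul_of_nonneg_right (min_le_left _ _) hB0.le).trans hη₁b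
  have hη' : η * ae * pP ≤ η₂ := by
    calc η * ae * pP ≤ η₂ / (ae * pP) * ae * pP := by gcongr; exact min_le_right _ _
      _ = η₂ := by field_simp
  obtain ⟨N, hN⟩ := exists_approx_of_dense hmono hdense u₁ (half_pos hη0)
  obtain ⟨C₀, hC₀, hnorm⟩ := exists_cbLe_of_norm_le (p i).2
  have htend : Tendsto (fun n : ℕ => c n * (C₀ * (1 / ((n : ℝ) + 1)))) atTop (𝓝 0) := by
    simpa using hc.mul (tendsto_one_div_add_atTop_nhds_zero_nat.const_mul C₀)
  -- Large `n` makes all constants of the chain at most `q`, includes the pattern `i`, makes the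
  -- error of the net at most `η / 2` in cb norm, and admits `u₂` among the maps of norm at most
  -- `n`.
  obtain ⟨n, hnN, hni, hcn, hcn', hκn, hsmall, hlarge⟩ := ((eventually_ge_atTop N).and
    ((eventually_ge_atTop i).and ((hc.eventually_le_const hq).and
    (((hc.comp (tendsto_add_atTop_nat 1)).eventually_le_const hq).and
    ((hκ.eventually_le_const hq).and ((htend.eventually_le_const (half_pos hη0)).and
    (tendsto_natCast_atTop_atTop.eventually_ge_atTop (q * (q * A))))))))).exists
  simp only [Function.comp_apply] at hcn'
  have hcp : 0 < c n := one_pos.trans_le (hc1 n)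
  have hcp' : 0 < c (n + 1) := one_pos.trans_le (hc1 (n + 1))
  -- approximation in the sequence
  obtain ⟨u₂, hu₂⟩ := hN n hnN
  obtain ⟨k1, k2⟩ := bounds_of_close hq hB0 hu₁a hu₁b hηa hηb (hu₂.mono (half_le_self hη0.le))
  have hu₂n : ∀ x, ‖u₂ x‖ ≤ n * ‖x‖ := fun x =>
    ((CBLe.of_comp (h2 n) k1 hcp.le).norm_le x).trans
      (by gcongr; exact (by gcongr : c n * (q * A) ≤ q * (q * A)).trans hlarge)
  have hu₂i : Function.Injective u₂ := fun x y hxy => k2.injective (by simp [hxy])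
  obtain ⟨u₃, hu₃, v, hv, hD⟩ := hw n i hni u₂ hu₂i hu₂n
  have hu₃' := (h1 n).comp (hnorm _ _ _ (by positivity) hu₃) hcp.le
  have hu₃c : CBLe (j n ∘ₗ u₃ - u₁) η := by
    have := (hu₃'.mono hsmall).add hu₂
    rw [add_halves] at this
    convert this using 1
    ext x
    simp
  obtain ⟨m1, m2⟩ := bounds_of_close hq hB0 hu₁a hu₁b hηa hηb hu₃c
  have hDu₃ : Distort u₃ (q ^ 7 * C) := by
    refine (distort_of_bounds (by positivity) (by positivity) (CBLe.of_comp (h2 n) m1 hcp.le)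
      (CBGe.of_comp (h1 n) m2 (by positivity))).mono ?_
    calc c n * (q * A) * (q * B * c n) ≤ q * (q * A) * (q * B * q) := by gcongr
      _ = q ^ 4 * (A * B) := by ring
      _ ≤ q ^ 4 * (q ^ 3 * C) := by gcongr
      _ = _ := by ring
  have hq1 : ∀ k, 1 ≤ q ^ k := fun k => one_le_pow₀ hq.le
  have hDv : Distort v (q * (q ^ 7 * C)) :=
    (hD _ (by nlinarith [hq1 7]) hDu₃).mono (by gcongr)
  let V₂ : L₀ →ₗ[ℂ] X := j (n + 1) ∘ₗ v ∘ₗ (e : L₀ →ₗ[ℂ] (p i).1)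
  have hV₂S : ∀ s : S, V₂ s = j n (u₃ (eS s)) := fun s => by
    have := hv (eS s)
    rw [heS] at this
    simp [V₂, this, hjw]
  have hDV₂ : Distort V₂ (q ^ 13 * C) := by
    refine ((distort_of_bounds hcp' hcp' (h1 _) (h2 _)).comp
      (hDv.comp ⟨ae, be, hae, hbe, habe, hea, heb⟩)).mono ?_
    calc c (n + 1) * c (n + 1) * (q * (q ^ 7 * C) * (q * q * q))
        ≤ q * q * (q * (q ^ 7 * C) * (q * q * q)) := by gcongr
      _ = _ := by ring
  -- If `S = 0` there is nothing to correct, and no vector from which to bound `a₂` below.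
  rcases subsingleton_or_nontrivial S with hS | hS
  · refine ⟨V₂, fun s => ?_, hDV₂.mono ?_⟩
    · rw [hV₂S, Subsingleton.elim s 0]; simp
    · gcongr
      calc q ^ 13 ≤ q ^ 15 := pow_le_pow_right₀ hq.le (by norm_num)
        _ ≤ _ := hqε
  obtain ⟨s₀, hs₀⟩ := exists_ne (0 : S)
  have hs₀' : 0 < ‖s₀‖ := norm_pos_iff.2 hs₀
  obtain ⟨a₂, b₂, ha₂, hb₂, hab₂, n1, n2⟩ := hDV₂
  have hlow : (q * B * be)⁻¹ ≤ a₂ := by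
    rw [inv_le_iff_one_le_mul₀ (by positivity)]
    refine le_of_mul_le_mul_right ?_ hs₀'
    calc 1 * ‖s₀‖ ≤ be * ‖eS s₀‖ := by rw [one_mul]; exact heSb.le_norm s₀
      _ ≤ be * (q * B * ‖j n (u₃ (eS s₀))‖) := by gcongr; exact m2.le_norm _
      _ = be * (q * B * ‖V₂ s₀‖) := by rw [hV₂S]
      _ ≤ be * (q * B * (a₂ * ‖s₀‖)) := by gcongr; exact n1.norm_le _
      _ = _ := by ring
  have hup : b₂ ≤ q ^ 13 * C * (q * B * be) := by
    rw [inv_le_iff_one_le_mul₀ (by positivity)] at hlow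
    calc b₂ = b₂ * 1 := by ring
      _ ≤ b₂ * (a₂ * (q * B * be)) := by gcongr
      _ = (a₂ * b₂) * (q * B * be) := by ring
      _ ≤ _ := by gcongr
  -- The error of `V₂` on `S`, extended to `L₀` through the projection `P`.
  let R : L₀ →ₗ[ℂ] X := (u - (j n ∘ₗ u₃) ∘ₗ (eS : S →ₗ[ℂ] (p i).2)) ∘ₗ P
  have hR : CBLe R (η * ae * pP) := by
    have e1 : u - (j n ∘ₗ u₃) ∘ₗ (eS : S →ₗ[ℂ] (p i).2) =
        (u₁ - j n ∘ₗ u₃) ∘ₗ (eS : S →ₗ[ℂ] (p i).2) := by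
      ext s
      simp [hu₁]
    have := (hu₃c.sub_comm.comp heSa hη0.le).comp hPle (by positivity)
    rw [← e1] at this
    exact this
  have hfinal : CBLe (V₂ + R - V₂) η₂ := by
    rw [add_sub_cancel_left]
    exact hR.mono hη'
  obtain ⟨r1, r2⟩ := bounds_of_close hq hb₂ n1 n2
    (hη₂a.trans (mul_le_mul_of_nonneg_left hlow (by linarith)))
    ((mul_le_mul_of_nonneg_left hup hη₂.le).trans hη₂b) hfinal
  refine ⟨V₂ + R, fun s => ?_, (distort_of_bounds (by positivity) (by positivity) r1 r2).mono ?_⟩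
  · rw [LinearMap.add_apply, hV₂S]
    simp [R, hPs]
  · calc q * a₂ * (q * b₂) = q ^ 2 * (a₂ * b₂) := by ring
      _ ≤ q ^ 2 * (q ^ 13 * C) := by gcongr
      _ = q ^ 15 * C := by ring
      _ ≤ _ := by gcongr

end Limit

/-! ### Maps defined on the union of an increasing sequence of subspaces -/

instance (X : OpSpace.{u}) : CompleteSpace X :=
  (X.isClosed_space.completeSpace_coe : CompleteSpace X.space)

/-! ### Continuity of matrix norms in the entries -/

section Continuity

variable {V : Type u} [NormedAddCommGroup V] [NormedSpace ℂ V] [MatrixNorms V] [ConcreteNorms V]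
  {k : ℕ}

theorem mnorm_single_le (i j : Fin k) (v : V) : mnorm (Matrix.single i j v) ≤ ‖v‖ := by
  obtain ⟨H, _, _, ι, hι⟩ := ConcreteNorms.exists_rep (V := V)
  rw [hι, ← ι.norm_map]
  refine norm_matrixOperator_le (norm_nonneg _) fun ξ => ?_
  have h : ∀ i', ∑ j', ((Matrix.single i j v).map ι) i' j' (ξ j') =
      if i' = i then ι v (ξ j) else 0 := by
    intro i'
    rw [Finset.sum_eq_single j]
    · by_cases hi : i' = i
      · subst hi; simp
      · simp [hi, Ne.symm hi]
    · intro j' _ hj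
      simp [Ne.symm hj]
    · simp
  simp only [h]
  rw [Finset.sum_eq_single i (fun i' _ hi => by simp [hi]) (by simp), if_pos rfl]
  calc ‖ι v (ξ j)‖ ^ 2 ≤ (‖ι v‖ * ‖ξ j‖) ^ 2 := by gcongr; exact (ι v).le_opNorm _
    _ = ‖ι v‖ ^ 2 * ‖ξ j‖ ^ 2 := mul_pow _ _ _
    _ ≤ _ := by
      gcongr
      exact Finset.single_le_sum (f := fun j => ‖ξ j‖ ^ 2) (fun _ _ => by positivity)
        (Finset.mem_univ j)

theorem mnorm_le_sum (x : Matrix (Fin k) (Fin k) V) : mnorm x ≤ ∑ i, ∑ j, ‖x i j‖ := by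
  conv_lhs => rw [Matrix.matrix_eq_sum_single x]
  refine (mnorm_sum_le _ _).trans (Finset.sum_le_sum fun i _ => ?_)
  exact (mnorm_sum_le _ _).trans (Finset.sum_le_sum fun j _ => mnorm_single_le i j _)

theorem tendsto_mnorm {f : ℕ → Matrix (Fin k) (Fin k) V} {x : Matrix (Fin k) (Fin k) V}
    (h : ∀ i j, Tendsto (fun m => f m i j) atTop (𝓝 (x i j))) :
    Tendsto (fun m => mnorm (f m)) atTop (𝓝 (mnorm x)) := by
  have h0 : Tendsto (fun m => ∑ i, ∑ j, ‖(f m - x) i j‖) atTop (𝓝 0) := by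
    rw [show (0 : ℝ) = ∑ i : Fin k, ∑ j : Fin k, 0 by simp]
    refine tendsto_finsetSum _ fun i _ => tendsto_finsetSum _ fun j _ => ?_
    simpa using tendsto_iff_norm_sub_tendsto_zero.1 (h i j)
  refine tendsto_of_tendsto_of_dist tendsto_const_nhds
    (squeeze_zero (fun _ => dist_nonneg) (fun m => ?_) h0)
  rw [Real.dist_eq, abs_le]
  have e1 := mnorm_le_add_mnorm_sub x (f m)
  have e2 := mnorm_le_add_mnorm_sub (f m) x
  have e3 := mnorm_le_sum (f m - x)
  rw [mnorm_sub_comm] at e1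
  constructor <;> linarith

end Continuity

/-! ### Exhaustions and extension from a dense union -/

section Extension

variable {Y : OpSpace.{u}} {F : ℕ → Submodule ℂ Y}

/-- The vector `y₀` is placed in every subspace to serve as a reference for the scale of maps. -/
theorem exists_exhaustion (Y : OpSpace.{u}) [SeparableSpace Y] (y₀ : Y) :
    ∃ F : ℕ → Submodule ℂ Y, IsFDExhaustion Y F ∧ ∀ n, y₀ ∈ F n := by
  let s : ℕ → Set Y := fun n => insert y₀ (denseSeq Y '' Set.Iio n)
  have hs : Monotone s := fun m n h =>
    Set.insert_subset_insert (Set.image_mono (Set.Iio_subset_Iio h))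
  refine ⟨fun n => Submodule.span ℂ (s n), ⟨fun m n h => Submodule.span_mono (hs h), fun n =>
    FiniteDimensional.span_of_finite ℂ (((Set.finite_Iio n).image _).insert _), ?_⟩,
    fun n => Submodule.subset_span (Set.mem_insert _ _)⟩
  refine Set.eq_univ_of_univ_subset ((denseRange_denseSeq Y).closure_range.symm.subset.trans
    (closure_mono ?_))
  rintro _ ⟨n, rfl⟩
  exact Set.mem_iUnion.2 ⟨n + 1, Submodule.subset_span (Or.inr ⟨n, Nat.lt_succ_self n, rfl⟩)⟩

/-- The direct sum of the `F n` maps linearly to `Y` with dense range and, via the `θ n`, to `X`. By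
compatibility each of its elements can be evaluated in a single `F n`, so the second map is bounded
by `a` times the first and extends to `Y`. -/
theorem exists_continuous_extension {Y X : Type u} [NormedAddCommGroup Y] [NormedSpace ℂ Y]
    [NormedAddCommGroup X] [NormedSpace ℂ X] [CompleteSpace X] {F : ℕ → Submodule ℂ Y}
    (hF : Monotone F) (hdense : closure (⋃ n, (F n : Set Y)) = Set.univ) {θ : ∀ n, F n →ₗ[ℂ] X}
    (hθ : ∀ n (x : F n), θ (n + 1) ⟨x, hF n.le_succ x.2⟩ = θ n x) {a : ℝ}
    (ha : ∀ n x, ‖θ n x‖ ≤ a * ‖x‖) : ∃ g : Y →L[ℂ] X, ∀ n (x : F n), g x = θ n x := by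
  have hcompat : ∀ {m n : ℕ} (h : m ≤ n) (x : F m), θ n ⟨x, hF h x.2⟩ = θ m x := by
    intro m n h x
    induction n, h using Nat.le_induction with
    | base => rfl
    | succ n h ih => exact (hθ n ⟨x, hF h x.2⟩).trans ih
  let e : (Π₀ n, F n) →ₗ[ℂ] Y := DFinsupp.lsum ℕ fun n => (F n).subtype
  let f : (Π₀ n, F n) →ₗ[ℂ] X := DFinsupp.lsum ℕ θ
  have he : ∀ n (z : F n), e (DFinsupp.single n z) = z := fun n z =>
    DFinsupp.lsum_single _ _ _ _
  have hf : ∀ n (z : F n), f (DFinsupp.single n z) = θ n z := fun n z =>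
    DFinsupp.lsum_single _ _ _ _
  have hef : ∀ x, ∃ (n : ℕ) (z : F n), e x = z ∧ f x = θ n z := by
    intro x
    induction x using DFinsupp.induction with
    | h0 => exact ⟨0, 0, by simp, by simp⟩
    | ha i z x _ _ hx =>
      obtain ⟨n, z', hz1, hz2⟩ := hx
      refine ⟨max i n, ⟨z, hF (le_max_left i n) z.2⟩ + ⟨z', hF (le_max_right i n) z'.2⟩, ?_, ?_⟩
      · rw [map_add, hz1, he]; rfl
      · rw [map_add, map_add, hf, hz2, hcompat (le_max_left i n), hcompat (le_max_right i n)]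
  have hd : DenseRange e := by
    refine dense_iff_closure_eq.2
      (Set.eq_univ_of_univ_subset (hdense.symm.subset.trans (closure_mono ?_)))
    intro x hx
    obtain ⟨n, hn⟩ := Set.mem_iUnion.1 hx
    exact ⟨DFinsupp.single n ⟨x, hn⟩, he _ _⟩
  have hbound : ∃ C, ∀ x, ‖f x‖ ≤ C * ‖e x‖ := ⟨a, fun x => by
    obtain ⟨n, z, hz1, hz2⟩ := hef x
    rw [hz1, hz2]
    exact ha n z⟩
  refine ⟨f.extendOfNorm e, fun n z => ?_⟩
  have := LinearMap.extendOfNorm_eq hd hbound (DFinsupp.single n z)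
  rwa [he, hf] at this

/-- Matrices over `Y` are entrywise limits of matrices over the `F n`, and matrix norms are
continuous in the entries, so both bounds pass to the limit. -/
theorem exists_extension_of_exhaustion {X : OpSpace.{u}} (hF : IsFDExhaustion Y F)
    {θ : ∀ n, F n →ₗ[ℂ] X} (hθ : ∀ n (x : F n), θ (n + 1) ⟨x, hF.1 n.le_succ x.2⟩ = θ n x) {a b : ℝ}
    (h1 : ∀ n, CBLe (θ n) a) (h2 : ∀ n, CBGe (θ n) b) :
    ∃ g : Y →ₗ[ℂ] X, CBLe g a ∧ CBGe g b := by
  obtain ⟨g, hg⟩ := exists_continuous_extension hF.1 hF.2.2 hθ fun n x => (h1 n).norm_le x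
  -- matrices over `Y` are limits of matrices over the subspaces
  have happrox : ∀ (k : ℕ) (x : Matrix (Fin k) (Fin k) Y), ∃ (N : ℕ → ℕ)
      (z : ∀ m, Matrix (Fin k) (Fin k) (F (N m))),
      (∀ i j, Tendsto (fun m => (z m i j : Y)) atTop (𝓝 (x i j))) := by
    intro k x
    have h : ∀ i j, ∃ y : ℕ → Y, (∀ m, y m ∈ ⋃ n, (F n : Set Y)) ∧
        Tendsto y atTop (𝓝 (x i j)) := fun i j =>
      mem_closure_iff_seq_limit.1 (hF.2.2 ▸ Set.mem_univ (x i j))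
    choose y hy hlim using h
    have hy' : ∀ i j m, ∃ n, y i j m ∈ F n := fun i j m => Set.mem_iUnion.1 (hy i j m)
    choose N hN using hy'
    refine ⟨fun m => Finset.univ.sup fun i => Finset.univ.sup fun j => N i j m,
      fun m => Matrix.of fun i j => ⟨y i j m, hF.1 ?_ (hN i j m)⟩, hlim⟩
    exact (Finset.le_sup (f := fun j => N i j m) (Finset.mem_univ j)).trans
      (Finset.le_sup (f := fun i => Finset.univ.sup fun j => N i j m) (Finset.mem_univ i))
  refine ⟨g, fun k x => ?_, fun k x => ?_⟩ <;> obtain ⟨N, z, hz⟩ := happrox k x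
  all_goals
    have t1 := tendsto_mnorm (f := fun m => (z m).map fun s => (s : Y)) hz
    have t2 : Tendsto (fun m => mnorm ((z m).map (θ (N m)))) atTop (𝓝 (mnorm (x.map g))) :=
      tendsto_mnorm fun i j => by
        refine ((g.continuous.tendsto _).comp (hz i j)).congr fun m => ?_
        exact hg (N m) (z m i j)
  · exact le_of_tendsto_of_tendsto' t2 (t1.const_mul a) fun m => h1 (N m) k (z m)
  · exact le_of_tendsto_of_tendsto' t1 (t2.const_mul b) fun m => h2 (N m) k (z m)

theorem exists_dependent_seq {α : ℕ → Type*} (P : ∀ n, α n → Prop)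
    (R : ∀ n, α n → α (n + 1) → Prop) (h0 : ∃ x, P 0 x)
    (hs : ∀ n x, P n x → ∃ y, P (n + 1) y ∧ R n x y) :
    ∃ f : ∀ n, α n, ∀ n, P n (f n) ∧ R n (f n) (f (n + 1)) := by
  choose next hn using hs
  obtain ⟨x₀, hx₀⟩ := h0
  let f : ∀ n, {x : α n // P n x} := fun n =>
    Nat.rec ⟨x₀, hx₀⟩ (fun n x => ⟨next n x x.2, (hn n x x.2).1⟩) n
  exact ⟨fun n => (f n).1, fun n => ⟨(f n).2, (hn n (f n).1 (f n).2).2⟩⟩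

theorem LocallyEmbeds.exists_embedding {𝓔 : Set OpSpace.{u}} (hY : LocallyEmbeds Y 𝓔)
    (F : Submodule ℂ Y) [FiniteDimensional ℂ F] {ρ : ℝ} (hρ : 1 < ρ) :
    ∃ G ∈ 𝓔, ∃ α : F →ₗ[ℂ] G, CBLe α ρ ∧ CBGe α ρ := by
  -- Half of the excess leaves room for an actual isomorphism of distortion at most `ρ`, since the
  -- infimum need not be attained.
  obtain ⟨G, hG, S, hS⟩ := hY F inferInstance ((ρ - 1) / 2) (by linarith)
  obtain ⟨e, a, b, ha, hb, hab, h1, h2⟩ := exists_equiv_of_dcb_lt (q := ρ) (by linarith)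
    (hS.trans_lt ((ENNReal.ofReal_lt_ofReal_iff (by linarith)).2 (by linarith)))
  have hc : ((a⁻¹ : ℝ) : ℂ) ≠ 0 := by exact_mod_cast (inv_pos.2 ha).ne'
  have hcn : ‖((a⁻¹ : ℝ) : ℂ)‖ = a⁻¹ := by
    rw [Complex.norm_real, Real.norm_of_nonneg (inv_pos.2 ha).le]
  -- Division by `a` gives the constants `1` and `a * b`, both at most `ρ`.
  refine ⟨G, hG, S.subtype ∘ₗ (((a⁻¹ : ℝ) : ℂ) • (e : F →ₗ[ℂ] S)), ?_, ?_⟩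
  · refine ((CBLe.subtype S).comp (h1.smul _) zero_le_one).mono ?_
    rw [hcn, inv_mul_cancel₀ ha.ne']
    linarith
  · refine ((CBGe.subtype S).comp (h2.smul hc) (by positivity)).mono ?_
    rw [hcn, div_inv_eq_mul]
    linarith

end Extension

/-! ### Embeddings into Gurarii spaces -/

section Universality

variable {𝓔 : Set OpSpace.{u}}

theorem bounds_of_subsingleton {V W : Type u} [NormedAddCommGroup V] [NormedSpace ℂ V]
    [MatrixNorms V] [ConcreteNorms V] [NormedAddCommGroup W] [NormedSpace ℂ W] [MatrixNorms W]
    [ConcreteNorms W] [Subsingleton V] (u : V →ₗ[ℂ] W) (a b : ℝ) : CBLe u a ∧ CBGe u b := by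
  have h : ∀ (n : ℕ) (x : Matrix (Fin n) (Fin n) V), x = 0 ∧ x.map u = 0 := fun n x =>
    ⟨Subsingleton.elim _ _, by ext i j; simp [Subsingleton.elim (x i j) 0]⟩
  refine ⟨fun n x => ?_, fun n x => ?_⟩ <;> rw [(h n x).1, (h n 0).2] <;> simp [mnorm_zero]

theorem Distort.smul {V W : Type u} [NormedAddCommGroup V] [NormedSpace ℂ V]
    [MatrixNorms V] [ConcreteNorms V] [NormedAddCommGroup W] [NormedSpace ℂ W] [MatrixNorms W]
    [ConcreteNorms W] {u : V →ₗ[ℂ] W} {C : ℝ} (h : Distort u C) {c : ℂ} (hc : c ≠ 0) :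
    Distort (c • u) C := by
  obtain ⟨a, b, ha, hb, hab, h1, h2⟩ := h
  have hc' : 0 < ‖c‖ := norm_pos_iff.2 hc
  refine ⟨‖c‖ * a, b / ‖c‖, by positivity, by positivity, ?_, h1.smul c, h2.smul hc⟩
  calc ‖c‖ * a * (b / ‖c‖) = a * b := by field_simp
    _ ≤ C := hab

/-- One step of the construction of an embedding into a Gurarii space. -/
theorem HasGurariiProperty.exists_extend_embedding (hfd : ∀ E ∈ 𝓔, FiniteDimensional ℂ E)
    {X Y : OpSpace.{u}} (hX : HasGurariiProperty X 𝓔) (hY : LocallyEmbeds Y 𝓔)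
    {F F' : Submodule ℂ Y} [FiniteDimensional ℂ F'] (hF : F ≤ F') {θ : F →ₗ[ℂ] X} {C κ : ℝ}
    (hC : 1 ≤ C) (hθ : Distort θ C) (hκ : 1 < κ) :
    ∃ θ' : F' →ₗ[ℂ] X, (∀ x : F, θ' ⟨x, hF x.2⟩ = θ x) ∧ Distort θ' (κ * C) := by
  obtain ⟨q, hq, hqκ⟩ := exists_pow_le hκ 5
  have hq0 : 0 < q := by linarith
  obtain ⟨G, hG, α, hα1, hα2⟩ := hY.exists_embedding F' hq
  have := hfd G hG
  -- The map `θ` is transported to the subspace `α(F)` of `G ∈ 𝓔`, extended to all of `G`, and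
  -- pulled back along `α`. The losses are `q ^ 2`, `q` and `q ^ 2`.
  let β : F →ₗ[ℂ] G := α ∘ₗ Submodule.inclusion hF
  have hβ : Distort β (q * q) :=
    (distort_of_bounds (by positivity) (by positivity) (hα1.comp (CBLe.inclusion hF) hq0.le)
      (hα2.comp (CBGe.inclusion hF) zero_le_one)).mono (by linarith)
  let e : F ≃ₗ[ℂ] LinearMap.range β := LinearEquiv.ofInjective β hβ.injective
  have he : Distort (e : F →ₗ[ℂ] LinearMap.range β) (q * q) := hβ
  let u : LinearMap.range β →ₗ[ℂ] X := θ ∘ₗ (e.symm : LinearMap.range β →ₗ[ℂ] F)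
  have hu : Distort u (C * (q * q)) := hθ.comp he.symm
  obtain ⟨v, hv, hvu, hD⟩ := hX (q - 1) (by linarith) G hG _ u hu.injective
  rw [add_sub_cancel] at hD
  have hDv := distort_of_distortion_le_mul hq hD (by nlinarith) hu
  refine ⟨v ∘ₗ α, fun x => ?_, (hDv.comp (distort_of_bounds hq0 hq0 hα1 hα2)).mono ?_⟩
  · have := hvu (e x)
    simp only [u, LinearMap.comp_apply, LinearEquiv.coe_coe, LinearEquiv.symm_apply_apply] at this
    exact this
  · calc q * (C * (q * q)) * (q * q) = q ^ 5 * C := by ring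
      _ ≤ _ := by gcongr

theorem HasGurariiProperty.exists_isEpsEmbedding (hfd : ∀ E ∈ 𝓔, FiniteDimensional ℂ E)
    {X Y : OpSpace.{u}} (hX : HasGurariiProperty X 𝓔) (hsep : SeparableSpace Y)
    (hY : LocallyEmbeds Y 𝓔) {ε : ℝ} (hε : 0 < ε) : ∃ u : Y →ₗ[ℂ] X, IsEpsEmbedding ε u := by
  rcases subsingleton_or_nontrivial Y with hsub | hnon
  · exact ⟨0, (isEpsEmbedding_iff hε.le).2 (bounds_of_subsingleton _ _ _)⟩
  obtain ⟨y₀, hy₀⟩ := exists_ne (0 : Y)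
  obtain ⟨F, hF, hyF⟩ := exists_exhaustion Y y₀
  have hFfd := hF.2.1
  -- A strictly increasing sequence below `1 + ε`; the ratios `e (n + 1) / e n > 1` are the losses
  -- allowed at the single steps.
  let e : ℕ → ℝ := fun n => 1 + ε * (1 - 1 / ((n : ℝ) + 2))
  have he1 : ∀ n, 1 < e n := fun n => by
    have : 1 / ((n : ℝ) + 2) < 1 := by
      rw [div_lt_one (by positivity)]; linarith [n.cast_nonneg (α := ℝ)]
    have : 0 < ε * (1 - 1 / ((n : ℝ) + 2)) := mul_pos hε (by linarith)
    simp only [e]; linarith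
  have hele : ∀ n, e n ≤ 1 + ε := fun n => by
    have : 0 ≤ 1 / ((n : ℝ) + 2) := by positivity
    simp only [e]; nlinarith
  have hmono : ∀ n, e n < e (n + 1) := fun n => by
    have : 1 / (((n + 1 : ℕ) : ℝ) + 2) < 1 / ((n : ℝ) + 2) := by
      push_cast; gcongr; linarith
    simp only [e]; nlinarith
  obtain ⟨θ, hθ⟩ := exists_dependent_seq (α := fun n => F n →ₗ[ℂ] X) (fun n θ => Distort θ (e n))
    (fun n θ θ' => ∀ x : F n, θ' ⟨x, hF.1 n.le_succ x.2⟩ = θ x)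
    (by
      have h0 : Distort (0 : (⊥ : Submodule ℂ Y) →ₗ[ℂ] X) 1 :=
        ⟨1, 1, one_pos, one_pos, by simp, bounds_of_subsingleton _ _ _⟩
      obtain ⟨θ, -, hθ⟩ := hX.exists_extend_embedding hfd hY (bot_le : ⊥ ≤ F 0) le_rfl h0 (he1 0)
      exact ⟨θ, by simpa using hθ⟩)
    (fun n θ hθ => by
      obtain ⟨θ', h1, h2⟩ := hX.exists_extend_embedding hfd hY (hF.1 n.le_succ) (he1 n).le hθ
        ((one_lt_div (by linarith [he1 n])).2 (hmono n))
      rw [div_mul_cancel₀ _ (by linarith [he1 n])] at h2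
      exact ⟨θ', h2, h1⟩)
  have hfix : ∀ n, θ n ⟨y₀, hyF n⟩ = θ 0 ⟨y₀, hyF 0⟩ := fun n => by
    induction n with
    | zero => rfl
    | succ n ih => rw [← ih]; exact (hθ n).2 ⟨y₀, hyF n⟩
  have hne : θ 0 ⟨y₀, hyF 0⟩ ≠ 0 := fun h => hy₀ <| by
    have := (hθ 0).1.injective (h.trans (map_zero _).symm)
    exact congrArg Subtype.val this
  have hpos : 0 < ‖θ 0 ⟨y₀, hyF 0⟩‖ := norm_pos_iff.2 hne
  have hpos' : 0 < ‖y₀‖ := norm_pos_iff.2 hy₀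
  -- The maps `θ n` agree at `y₀`, so a single scalar normalises them all there, and the bounds on
  -- the distortion become two-sided bounds.
  let c : ℂ := ((‖y₀‖ / ‖θ 0 ⟨y₀, hyF 0⟩‖ : ℝ) : ℂ)
  have hc : c ≠ 0 := Complex.ofReal_ne_zero.2 (div_pos hpos' hpos).ne'
  have hcn : ∀ n, ‖(c • θ n) ⟨y₀, hyF n⟩‖ = ‖(⟨y₀, hyF n⟩ : F n)‖ := fun n => by
    rw [LinearMap.smul_apply, norm_smul, hfix, Complex.norm_real,
      Real.norm_of_nonneg (div_pos hpos' hpos).le, div_mul_cancel₀ _ hpos.ne']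
    rfl
  have hb : ∀ n, CBLe (c • θ n) (1 + ε) ∧ CBGe (c • θ n) (1 + ε) := fun n => by
    have := (((hθ n).1.smul hc).mono (hele n)).bounds one_pos (x := ⟨y₀, hyF n⟩)
      (fun h => hy₀ (congrArg Subtype.val h)) (by rw [hcn, one_mul]) (by rw [hcn, one_mul])
    rwa [mul_one] at this
  obtain ⟨g, hg⟩ := exists_extension_of_exhaustion hF (θ := fun n => c • θ n)
    (fun n x => by rw [LinearMap.smul_apply, LinearMap.smul_apply, (hθ n).2 x])
    (fun n => (hb n).1) (fun n => (hb n).2)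
  exact ⟨g, (isEpsEmbedding_iff hε.le).2 hg⟩

end Universality

/-! ### Construction of Gurarii spaces -/

section Construction

variable {𝓔 : Set OpSpace.{u}}

theorem isFDExhaustion_range {X : OpSpace.{u}} {L : ℕ → OpSpace.{u}} {w : ∀ n, L n →ₗ[ℂ] L (n + 1)}
    {j : ∀ n, L n →ₗ[ℂ] X} (hfd : ∀ n, FiniteDimensional ℂ (L n))
    (hjw : ∀ n x, j (n + 1) (w n x) = j n x)
    (hdense : closure (⋃ n, (LinearMap.range (j n) : Set X)) = Set.univ) :
    IsFDExhaustion X fun n => LinearMap.range (j n) :=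
  ⟨monotone_range_of_compat hjw, fun n => LinearMap.finiteDimensional_range (j n), hdense⟩

/-- A sequence in the class whose maps are almost completely isometric and solve extension problems
has a Gurarii space as its limit. -/
theorem exists_gurarii_limit (hfd : ∀ E ∈ 𝓔, FiniteDimensional ℂ E)
    {p : ℕ → (E : OpSpace.{u}) × Submodule ℂ E} (hp : ∀ i, (p i).1 ∈ 𝓔)
    (hpat : ∀ L ∈ 𝓔, ∀ S : Submodule ℂ L, ∀ q : ℝ, 1 < q → ∃ (i : ℕ) (e : L ≃ₗ[ℂ] (p i).1),
        S.map (e : L →ₗ[ℂ] (p i).1) = (p i).2 ∧ Distort (e : L →ₗ[ℂ] (p i).1) (q * q * q))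
    {L : ℕ → OpSpace.{u}} (hL : ∀ n, L n ∈ 𝓔) {w : ∀ n, L n →ₗ[ℂ] L (n + 1)} {c κ : ℕ → ℝ}
    (hc1 : ∀ n, 1 ≤ c n) (hc : Tendsto c atTop (𝓝 1)) (hκ : Tendsto κ atTop (𝓝 1))
    (h1 : ∀ n, CBLe (w n) (c n / c (n + 1))) (h2 : ∀ n, CBGe (w n) (c n / c (n + 1)))
    (hw : ∀ n, ExtendsPatterns p n (κ n) (w n)) :
    ∃ (X : OpSpace.{u}) (j : ∀ n, L n →ₗ[ℂ] X), IsGurariiSpace 𝓔 X ∧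
      (∀ n x, j (n + 1) (w n x) = j n x) ∧ (∀ n, CBLe (j n) (c n)) ∧ (∀ n, CBGe (j n) (c n)) ∧
      IsFDExhaustion X fun n => LinearMap.range (j n) := by
  obtain ⟨X, j, hjw, k1, k2, hdense⟩ := exists_chain_limit hc1 h1 h2
  have hLfd : ∀ n, FiniteDimensional ℂ (L n) := fun n => hfd _ (hL n)
  exact ⟨X, j, ⟨separableSpace_of_exhaustion hLfd hdense,
    hasGurariiProperty_limit hfd hp hpat hc1 hc hκ k1 k2 hjw hdense hw,
    locallyEmbeds_limit hL hc1 hc k1 k2 (monotone_range_of_compat hjw) hdense⟩, hjw, k1, k2,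
    isFDExhaustion_range hLfd hjw hdense⟩

/-- Amalgamation now keeps each stage completely isometrically, so all constants of the chain are 1
and the maps into the limit are complete isometries. -/
theorem IsGurariiClass.exists_gurarii_space (hfd : ∀ E ∈ 𝓔, FiniteDimensional ℂ E)
    (hne : ∃ E ∈ 𝓔, Nontrivial E) (hsep : IsSeparableClass 𝓔) (h : IsGurariiClass 𝓔) :
    ∃ X : OpSpace.{u}, IsGurariiSpace 𝓔 X ∧
      ∃ E : ℕ → Submodule ℂ X, IsFDExhaustion X E ∧ ∀ n, BelongsTo (E n) 𝓔 := by
  obtain ⟨p, hp, hpat⟩ := exists_patterns hfd hne hsep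
  let κ : ℕ → ℝ := fun n => 1 + 1 / ((n : ℝ) + 1)
  have hκ : Tendsto κ atTop (𝓝 1) := by
    have := (tendsto_one_div_add_atTop_nhds_zero_nat (𝕜 := ℝ)).const_add 1
    rwa [add_zero] at this
  have hκ1 : ∀ n, 1 < κ n := fun n => lt_add_of_pos_right _ (by positivity)
  obtain ⟨L, hL⟩ := exists_dependent_seq (α := fun _ => OpSpace.{u}) (fun _ L => L ∈ 𝓔)
    (fun n L L' => ∃ w : L →ₗ[ℂ] L', CBLe w 1 ∧ CBGe w 1 ∧ ExtendsPatterns p n (κ n) w)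
    (hne.imp fun E h => h.1) (fun n L hL => by
      obtain ⟨L', hL', w, hw⟩ := exists_extendsPatterns hfd (h.isAmalgamationScale hfd) hp hL n
        (Set.mem_singleton (1 : ℝ)) (hκ1 n)
      exact ⟨L', hL', w, hw⟩)
  choose hL𝓔 w h1 h2 hw using hL
  obtain ⟨X, j, hX, -, k1, k2, hE⟩ := exists_gurarii_limit hfd hp hpat hL𝓔 (c := fun _ => 1)
    (fun _ => le_rfl) tendsto_const_nhds hκ (by simpa using h1) (by simpa using h2) hw
  refine ⟨X, hX, _, hE, fun n => ⟨L n, hL𝓔 n,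
    (LinearEquiv.ofInjective (j n) (k2 n).injective).symm, isCompleteIsometry_iff.2 ⟨?_, ?_⟩⟩⟩
  · exact CBGe.of_equiv (e := LinearEquiv.ofInjective (j n) (k2 n).injective) (k2 n)
  · exact CBLe.of_equiv (e := LinearEquiv.ofInjective (j n) (k2 n).injective) (k1 n)

/-- In a loosely Gurarii class an approximate embedding of a finite-dimensional space can be
extended to a larger space and simultaneously made as good as desired, at the cost of changing the
range by a map that is controlled by the quality of the initial embedding. -/
theorem IsLooselyGurariiClass.exists_improve (hfd : ∀ E ∈ 𝓔, FiniteDimensional ℂ E)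
    (h : IsLooselyGurariiClass 𝓔) {Y : OpSpace.{u}} (hY : LocallyEmbeds Y 𝓔) {F F' : Submodule ℂ Y}
    [FiniteDimensional ℂ F'] (hF : F ≤ F') {x₀ : F} (hx₀ : x₀ ≠ 0) {M : OpSpace.{u}} (hM : M ∈ 𝓔)
    {θ : F →ₗ[ℂ] M} {a τ : ℝ} (hτ : 1 < τ) (hτa : τ ≤ a) (h1 : CBLe θ a) (h2 : CBGe θ a) :
    ∃ L ∈ 𝓔, ∃ (w : M →ₗ[ℂ] L) (θ' : F' →ₗ[ℂ] L), (∀ x : F, θ' ⟨x, hF x.2⟩ = w (θ x)) ∧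
      CBLe θ' (τ * τ) ∧ CBGe θ' (τ * τ) ∧ CBLe w (a ^ 8) ∧ CBGe w (a ^ 8) := by
  have hτ0 : 0 < τ := by linarith
  have ha0 : 0 < a := by linarith
  obtain ⟨G, hG, α, hα1, hα2⟩ := hY.exists_embedding F' hτ
  let e : F ≃ₗ[ℂ] LinearMap.range θ := LinearEquiv.ofInjective θ h2.injective
  have he : Distort (e : F →ₗ[ℂ] LinearMap.range θ) (a * a) := distort_of_bounds ha0 ha0 h1 h2
  let u : LinearMap.range θ →ₗ[ℂ] G :=
    (α ∘ₗ Submodule.inclusion hF) ∘ₗ (e.symm : LinearMap.range θ →ₗ[ℂ] F)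
  have hu : Distort u (τ * τ * (a * a)) :=
    Distort.comp ((distort_of_bounds (by positivity) (by positivity)
      (hα1.comp (CBLe.inclusion hF) hτ0.le)
      (hα2.comp (CBGe.inclusion hF) zero_le_one)).mono (by linarith)) he.symm
  -- Here `M` is the space to which a map is extended and `G` the one that is embedded with constant
  -- `τ`. Hence `φ ∘ α` is as good as `τ` permits, independently of `a`.
  obtain ⟨L, hL, φ, hφ1, hφ2, v, hv, hD⟩ :=
    h.amalgamatesAt hfd hτ M hM G hG _ u hu.injective τ hτ
  have haa : 1 ≤ a * a := by nlinarith
  have hDv := hD _ (by nlinarith) hu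
  have hext : ∀ x : F, φ (α ⟨x, hF x.2⟩) = v (θ x) := fun x => by
    have := hv (e x)
    simp only [u, LinearMap.comp_apply, LinearEquiv.coe_coe, LinearEquiv.symm_apply_apply] at this
    exact this.symm
  have m1 := hφ1.comp hα1 hτ0.le
  have m2 := hφ2.comp hα2 hτ0.le
  have hττ : τ * τ * a ≤ a ^ 3 := by
    calc τ * τ * a ≤ a * a * a := by gcongr
      _ = a ^ 3 := by ring
  have hne : θ x₀ ≠ 0 := fun h0 => hx₀ (h2.injective (h0.trans (map_zero _).symm))
  -- The distortion is at most `a ^ 5`. The scale is fixed at `θ x₀`: its image has norm within `τ *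
  -- τ` of `‖x₀‖`, which is within `a` of `‖θ x₀‖`. Together this gives `a ^ 8`.
  have hw := (hDv.mono (C' := a ^ 5) (by
    calc τ * (τ * τ * (a * a)) ≤ a * (a * a * (a * a)) := by gcongr
      _ = a ^ 5 := by ring)).bounds (s := a ^ 3) (by positivity) hne
    (by
      rw [← hext]
      calc _ ≤ τ * τ * ‖x₀‖ := m1.norm_le (⟨x₀, hF x₀.2⟩ : F')
        _ ≤ τ * τ * (a * ‖θ x₀‖) := by gcongr; exact h2.le_norm x₀
        _ = τ * τ * a * ‖θ x₀‖ := by ring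
        _ ≤ _ := by gcongr)
    (by
      rw [← hext]
      calc _ ≤ a * ‖x₀‖ := h1.norm_le _
        _ ≤ a * (τ * τ * ‖φ (α ⟨x₀, hF x₀.2⟩)‖) := by
          gcongr; exact m2.le_norm (⟨x₀, hF x₀.2⟩ : F')
        _ = τ * τ * a * ‖φ (α ⟨x₀, hF x₀.2⟩)‖ := by ring
        _ ≤ _ := by gcongr)
  rw [← pow_add] at hw
  exact ⟨L, hL, v, φ ∘ₗ α, hext, m1, m2, hw.1, hw.2⟩

end Construction

/-! ### Gurarii spaces over loosely Gurarii classes -/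

section LooselyGurarii

variable {𝓔 : Set OpSpace.{u}}

/-- A sequence of numbers decreasing to `1`, each the square of the next. -/
def rootSeq (n : ℕ) : ℝ := Real.exp ((1 / 2) ^ n)

theorem one_lt_rootSeq (n : ℕ) : 1 < rootSeq n := Real.one_lt_exp_iff.2 (by positivity)

theorem rootSeq_succ_mul_self (n : ℕ) : rootSeq (n + 1) * rootSeq (n + 1) = rootSeq n := by
  rw [rootSeq, rootSeq, ← Real.exp_add]
  congr 1
  ring

theorem tendsto_rootSeq : Tendsto rootSeq atTop (𝓝 1) := by
  rw [← Real.exp_zero]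
  exact (Real.continuous_exp.tendsto 0).comp
    (tendsto_pow_atTop_nhds_zero_of_lt_one (by norm_num) (by norm_num))

theorem tendsto_rootSeq_pow (k : ℕ) : Tendsto (fun n => rootSeq n ^ k) atTop (𝓝 1) := by
  simpa using tendsto_rootSeq.pow k

theorem tendsto_dcbClass_range {X : OpSpace.{u}}
    {L : ℕ → OpSpace.{u}} (hL : ∀ n, L n ∈ 𝓔) {j : ∀ n, L n →ₗ[ℂ] X} {c : ℕ → ℝ}
    (hc1 : ∀ n, 1 ≤ c n) (hc : Tendsto c atTop (𝓝 1)) (h1 : ∀ n, CBLe (j n) (c n))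
    (h2 : ∀ n, CBGe (j n) (c n)) :
    Tendsto (fun n => dcbClass (LinearMap.range (j n)) 𝓔) atTop (𝓝 1) := by
  have hup : Tendsto (fun n => ENNReal.ofReal (c n * c n)) atTop (𝓝 1) := by
    have := ENNReal.tendsto_ofReal (hc.mul hc)
    simpa using this
  refine tendsto_of_tendsto_of_tendsto_of_le_of_le tendsto_const_nhds hup (fun n => ?_) fun n => ?_
  · exact le_iInf₂ fun E _ => le_iInf fun e => le_max_left _ _
  · have hcn : 0 < c n := one_pos.trans_le (hc1 n)
    have h : Distort (LinearEquiv.ofInjective (j n) (h2 n).injective :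
        L n →ₗ[ℂ] LinearMap.range (j n)) (c n * c n) := distort_of_bounds hcn hcn (h1 n) (h2 n)
    exact (iInf₂_le (L n) (hL n)).trans ((iInf_le _ _).trans
      (h.symm.distortion_le (by nlinarith [hc1 n]) (LinearEquiv.injective _)))

/-- Each step first solves extension problems, which spoils the embedding of `F n`, and then repairs
the embedding while extending it to `F (n + 1)`. -/
theorem IsLooselyGurariiClass.exists_gurarii_space_of_ne_zero
    (hfd : ∀ E ∈ 𝓔, FiniteDimensional ℂ E) (hne : ∃ E ∈ 𝓔, Nontrivial E)
    (hsep : IsSeparableClass 𝓔) (h : IsLooselyGurariiClass 𝓔) {Y : OpSpace.{u}}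
    (hYsep : SeparableSpace Y) (hY : LocallyEmbeds Y 𝓔) {y₀ : Y} (hy₀ : y₀ ≠ 0) :
    ∃ X : OpSpace.{u}, IsGurariiSpace 𝓔 X ∧ (∃ j : Y →ₗ[ℂ] X, IsCompleteIsometry j) ∧
      ∃ E : ℕ → Submodule ℂ X, IsFDExhaustion X E ∧
        Tendsto (fun n => dcbClass (E n) 𝓔) atTop (𝓝 1) := by
  obtain ⟨p, hp, hpat⟩ := exists_patterns hfd hne hsep
  obtain ⟨F, hF, hyF⟩ := exists_exhaustion Y y₀
  have hFfd := hF.2.1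
  obtain ⟨σ, hσ⟩ := exists_dependent_seq (α := fun n => (L : OpSpace.{u}) × (F n →ₗ[ℂ] L))
    (fun n x => x.1 ∈ 𝓔 ∧ CBLe x.2 (rootSeq n) ∧ CBGe x.2 (rootSeq n))
    (fun n x x' => ∃ w : x.1 →ₗ[ℂ] x'.1, CBLe w (rootSeq n ^ 17) ∧ CBGe w (rootSeq n ^ 17) ∧
      ExtendsPatterns p n (rootSeq n ^ 33) w ∧
      ∀ y : F n, x'.2 ⟨y, hF.1 n.le_succ y.2⟩ = w (x.2 y))
    (by
      obtain ⟨G, hG, α, hα⟩ := hY.exists_embedding (F 0) (one_lt_rootSeq 0)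
      exact ⟨⟨G, α⟩, hG, hα⟩)
    (by
      rintro n ⟨L, θ⟩ ⟨hL, hθ1, hθ2⟩
      dsimp only at hL hθ1 hθ2
      have hρ := one_lt_rootSeq n
      have hρ0 : 0 < rootSeq n := by linarith
      obtain ⟨M, hM, φ, hφ1, hφ2, hφ⟩ := exists_extendsPatterns hfd (h.isAmalgamationScale hfd) hp
        hL n (Set.mem_Ioi.2 hρ) hρ
      have hτ := one_lt_rootSeq (n + 2)
      have e1 := rootSeq_succ_mul_self n
      have e2 := rootSeq_succ_mul_self (n + 1)
      have e3 := one_lt_rootSeq (n + 1)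
      -- With `ρ = rootSeq n`, the map `φ ∘ θ` has constant `a = ρ ^ 2`, so `w` has constant `a ^ 8
      -- = ρ ^ 16` and `w ∘ φ` has `ρ ^ 17`. The choice `τ = rootSeq (n + 2)` gives the new
      -- embedding the constant `τ * τ = rootSeq (n + 1)`.
      obtain ⟨L', hL', w, θ', hww, k1, k2, l1, l2⟩ := h.exists_improve hfd hY (hF.1 n.le_succ)
        (x₀ := ⟨y₀, hyF n⟩) (fun h0 => hy₀ (congrArg Subtype.val h0)) hM
        (θ := φ ∘ₗ θ) (a := rootSeq n * rootSeq n) hτ (by nlinarith)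
        (hφ1.comp hθ1 hρ0.le) (hφ2.comp hθ2 hρ0.le)
      rw [e2] at k1 k2
      refine ⟨⟨L', θ'⟩, ⟨hL', k1, k2⟩, w ∘ₗ φ, ?_, ?_, ?_, hww⟩
      · convert l1.comp hφ1 (by positivity) using 1; ring
      · convert l2.comp hφ2 hρ0.le using 1; ring
      · convert hφ.comp (distort_of_bounds (by positivity) (by positivity) l1 l2) using 1; ring)
  choose hσP w h1 h2 hw hwθ using hσ
  -- Since `rootSeq (n + 1)` is the square root of `rootSeq n`, the ratio of consecutive 34th powers
  -- is exactly the bound `rootSeq n ^ 17` of the chain maps.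
  have hc1 : ∀ n, 1 ≤ rootSeq n ^ 34 := fun n => one_le_pow₀ (one_lt_rootSeq n).le
  have hratio : ∀ n, rootSeq n ^ 34 / rootSeq (n + 1) ^ 34 = rootSeq n ^ 17 := fun n => by
    have h0 : rootSeq (n + 1) ^ 34 ≠ 0 := (one_pos.trans_le (hc1 (n + 1))).ne'
    rw [div_eq_iff h0, ← rootSeq_succ_mul_self n]
    ring
  obtain ⟨X, j, hX, hjw, k1, k2, hE⟩ := exists_gurarii_limit hfd hp hpat (fun n => (hσP n).1)
    (c := fun n => rootSeq n ^ 34) hc1 (tendsto_rootSeq_pow 34) (tendsto_rootSeq_pow 33)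
    (fun n => by rw [hratio]; exact h1 n) (fun n => by rw [hratio]; exact h2 n) hw
  refine ⟨X, hX, ?_, _, hE,
    tendsto_dcbClass_range (fun n => (hσP n).1) hc1 (tendsto_rootSeq_pow 34) k1 k2⟩
  let θ : ∀ n, F n →ₗ[ℂ] X := fun n => j n ∘ₗ (σ n).2
  have hθ : ∀ n (x : F n), θ (n + 1) ⟨x, hF.1 n.le_succ x.2⟩ = θ n x := fun n x => by
    simp only [θ, LinearMap.comp_apply]
    rw [hwθ, hjw]
  have hθ' : ∀ {m n : ℕ} (hmn : m ≤ n), θ n ∘ₗ Submodule.inclusion (hF.1 hmn) = θ m := by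
    intro m n hmn
    induction n, hmn using Nat.le_induction with
    | base => rfl
    | succ n hmn ih =>
      rw [← ih]
      ext x
      exact hθ n ⟨x, hF.1 hmn x.2⟩
  have hp0 : ∀ n, 0 < rootSeq n := fun n => one_pos.trans (one_lt_rootSeq n)
  -- The map `θ m` is a restriction of every later `θ n`, so it inherits bounds that tend to 1 and
  -- is completely isometric.
  have b1 : ∀ {m n : ℕ}, m ≤ n → CBLe (θ m) (rootSeq n ^ 35) := fun {m n} hmn => by
    rw [← hθ' hmn]
    convert ((k1 n).comp (hσP n).2.1 (pow_pos (hp0 n) _).le).comp (CBLe.inclusion (hF.1 hmn))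
      (mul_pos (pow_pos (hp0 n) _) (hp0 n)).le using 1
    ring
  have b2 : ∀ {m n : ℕ}, m ≤ n → CBGe (θ m) (rootSeq n ^ 35) := fun {m n} hmn => by
    rw [← hθ' hmn]
    convert ((k2 n).comp (hσP n).2.2 (hp0 n).le).comp (CBGe.inclusion (hF.1 hmn))
      zero_le_one using 1
    ring
  obtain ⟨g, hg⟩ := exists_extension_of_exhaustion hF hθ (a := 1) (b := 1)
    (fun m k x => ge_of_tendsto ((tendsto_rootSeq_pow 35).mul_const _)
      ((eventually_ge_atTop m).mono fun n hn => b1 hn k x))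
    (fun m k x => ge_of_tendsto ((tendsto_rootSeq_pow 35).mul_const _)
      ((eventually_ge_atTop m).mono fun n hn => b2 hn k x))
  exact ⟨g, isCompleteIsometry_iff.2 hg⟩

theorem locallyEmbeds_of_mem {E : OpSpace.{u}}
    (hE : E ∈ 𝓔) : LocallyEmbeds E 𝓔 := fun F _ ε hε => by
  refine ⟨E, hE, F, (iInf_le _ (LinearEquiv.refl ℂ F)).trans ?_⟩
  have : Distort (LinearEquiv.refl ℂ F : F →ₗ[ℂ] F) (1 + ε) :=
    ⟨1, 1, one_pos, one_pos, by linarith, CBLe.id, CBGe.id⟩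
  exact this.distortion_le (by linarith) _

theorem IsLooselyGurariiClass.exists_gurarii_space
    (hfd : ∀ E ∈ 𝓔, FiniteDimensional ℂ E) (hne : ∃ E ∈ 𝓔, Nontrivial E)
    (hsep : IsSeparableClass 𝓔) (h : IsLooselyGurariiClass 𝓔) {Y : OpSpace.{u}}
    (hYsep : SeparableSpace Y) (hY : LocallyEmbeds Y 𝓔) :
    ∃ X : OpSpace.{u}, IsGurariiSpace 𝓔 X ∧ (∃ j : Y →ₗ[ℂ] X, IsCompleteIsometry j) ∧
      ∃ E : ℕ → Submodule ℂ X, IsFDExhaustion X E ∧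
        Tendsto (fun n => dcbClass (E n) 𝓔) atTop (𝓝 1) := by
  rcases subsingleton_or_nontrivial Y with hsub | hnon
  -- The construction needs a nonzero reference vector. For `Y = 0` it is run with a nonzero member
  -- of the class in place of `Y`.
  · obtain ⟨E, hE, hEnon⟩ := hne
    obtain ⟨x, hx⟩ := exists_ne (0 : E)
    have := hfd E hE
    have : ProperSpace E := FiniteDimensional.proper ℂ E
    obtain ⟨X, hX, -, hexh⟩ := h.exists_gurarii_space_of_ne_zero hfd ⟨E, hE, hEnon⟩ hsep
      inferInstance (locallyEmbeds_of_mem hE) hx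
    exact ⟨X, hX, ⟨0, isCompleteIsometry_iff.2 (bounds_of_subsingleton _ _ _)⟩, hexh⟩
  · obtain ⟨y₀, hy₀⟩ := exists_ne (0 : Y)
    exact h.exists_gurarii_space_of_ne_zero hfd hne hsep hYsep hY hy₀

end LooselyGurarii
end

theorem theorem4p22 (𝓔 : Set OpSpace.{u})
    (hfd : ∀ E ∈ 𝓔, FiniteDimensional ℂ E)
    (hne : ∃ E ∈ 𝓔, Nontrivial E)
    (hsep : IsSeparableClass 𝓔) :
    (IsLooselyGurariiClass 𝓔 →
      ∀ Y : OpSpace.{u}, SeparableSpace Y → LocallyEmbeds Y 𝓔 →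
        ∃ X : OpSpace.{u}, IsGurariiSpace 𝓔 X ∧
          (∃ j : Y →ₗ[ℂ] X, IsCompleteIsometry j) ∧
          ∃ E : ℕ → Submodule ℂ X, IsFDExhaustion X E ∧
            Tendsto (fun n => dcbClass (E n) 𝓔) atTop (𝓝 1)) ∧
    (IsGurariiClass 𝓔 →
      ∃ X : OpSpace.{u}, IsGurariiSpace 𝓔 X ∧
        (∃ E : ℕ → Submodule ℂ X, IsFDExhaustion X E ∧ ∀ n, BelongsTo (E n) 𝓔) ∧
        ∀ Y : OpSpace.{u}, SeparableSpace Y → LocallyEmbeds Y 𝓔 →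
          ∀ ε : ℝ, 0 < ε → ∃ u : Y →ₗ[ℂ] X, IsEpsEmbedding ε u) := by
  refine ⟨fun h Y hYsep hY => h.exists_gurarii_space hfd hne hsep hYsep hY, fun h => ?_⟩
  obtain ⟨X, hX, hE⟩ := h.exists_gurarii_space hfd hne hsep
  exact ⟨X, hX, hE, fun Y hYsep hY ε hε => hX.2.1.exists_isEpsEmbedding hfd hYsep hY hε⟩
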